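/- **Setting.** A state assigns a real number to each variable. Hybrid programs are generated by $x:=\theta$, $x:=*$, $?F$, $\{x_1'=\theta_1,\dots,x_n'=\theta_n\,\&\,F\}$, $\alpha\cup\beta$, $\alpha;\beta$, $\alpha^*$, and $[\![\alpha]\!]$ denotes the usual transition relation of $\alpha$ on states. Formulas of differential dynamic logic (dL) are built from comparisons of polynomial terms over $\mathbb R$ with propositional connectives, quantifiers over $\mathbb R$, and the modalities $[\alpha]$, $\langle\alpha\rangle$; $s\models\varphi$ is truth in state $s$ and $\vdash\varphi$ is provability in the proof calculus of dL. An action $u$ is a mapping from variables to terms, and $u(s)$ is the state obtained from $s$ by the corresponding simultaneous assignment. A *monitored model* $m$ is a dL formula $\mathit{init}\to[\{\mathit{ctrl};\mathit{plant}\}^*]\,\mathit{safe}$ with exactly one modality and loop-free $\mathit{ctrl}$, together with a controller monitor $\mathit{cm}$ and a model monitor $\mathit{mm}$, which are Boolean functions such that $\mathit{cm}(s,u)$ implies $(s,u(s))\in[\![\mathit{ctrl}]\!]$, and $\mathit{mm}(s,u,t)$ implies $(s,u(s))\in[\![\mathit{ctrl}]\!]$ and $(u(s),t)\in[\![\mathit{plant}]\!]$.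 Let $\mathcal A$ be a finite set of actions, $M$ a finite set of monitored models, and $E$ a function (the environment) mapping an action and a state to a state. A *μlearning process* $P_M=(\mathbf U,\mathbf S,\mathbf{Mon})$ consists of finite or infinite sequences of actions $\mathbf U_i\in\mathcal A$, states $\mathbf S_i$ and sets $\mathbf{Mon}_i$ of monitored models, with $\mathbf{Mon}_0=M$ and $\mathbf S_{i+1}=E(\mathbf U_i,\mathbf S_i)$, such that 1. for each $i<|\mathbf S|$ there is an action $u\in\mathcal A$ such that for all $m\in\mathbf{Mon}_i$: $i=0$, or $\mathit{cm}_m(\mathbf S_i,u)$, or $\neg\mathit{mm}_m(\mathbf S_{i-1},\mathbf U_{i-1},\mathbf S_i)$; 2. for each $i$ with $i+1<|\mathbf S|$ and all $m\in\mathbf{Mon}_i$: $\mathit{cm}_m(\mathbf S_i,\mathbf U_i)$; 3. for each $i$ with $i+1<|\mathbf S|$ and all $m\in\mathbf{Mon}_i$: if $\mathit{mm}_m(\mathbf S_i,\mathbf U_i,\mathbf S_{i+1})$ then $m\in\mathbf{Mon}_{i+1}$. A model $m^*=(\mathit{init}\to[\{\mathit{ctrl};\mathit{plant}\}^*]\,\mathit{safe},\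 \mathit{cm},\ \mathit{mm})\in\mathbf{Mon}_0$ is *accurate* for $P_M$ in the environment $E$ if * $\vdash \mathit{init}\to[\{\mathit{ctrl};\mathit{plant}\}^*]\,\mathit{safe}$; * for all $u\in\mathcal A$ and all states $s$: $(s,u(s))\in[\![\mathit{ctrl}]\!]$ implies $(u(s),E(u,s))\in[\![\mathit{plant}]\!]$; * $\mathbf S_0\models\mathit{init}$; * its model monitor is exact: for all $u\in\mathcal A$ and all states $s,t$, if $(s,u(s))\in[\![\mathit{ctrl}]\!]$ and $(u(s),t)\in[\![\mathit{plant}]\!]$ then $\mathit{mm}(s,u,t)$. **Theorem (Safety).** Let $P_M=(\mathbf U,\mathbf S,\mathbf{Mon})$ be a μlearning process in an environment $E$ and let $m^*$ be an accurate model for it, with postcondition $\mathit{safe}$. Then $\mathbf S_i\models\mathit{safe}$ for all $0<i<|\mathbf S|$. -/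

import Mathlib

/-! Differential dynamic logic: hybrid programs, formulas, semantics, proof calculus; then
monitored models and μlearning processes. -/

namespace DL

universe u

/-- A state assigns a real number to each variable. -/
abbrev State (V : Type*) := V → ℝ

/-! ### Terms -/

/-- Arithmetic expressions over the reals. -/
inductive Term (V : Type*) where
  | var (x : V)
  | const (r : ℝ)
  | neg (e : Term V)
  | add (e₁ e₂ : Term V)
  | sub (e₁ e₂ : Term V)
  | mul (e₁ e₂ : Term V)
  | pow (e : Term V) (n : ℕ)

namespace Term

variable {V : Type*}

/-- The value of a term in a state. -/
def eval : Term V → State V → ℝ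
  | var x, s => s x
  | const r, _ => r
  | neg e, s => - e.eval s
  | add e₁ e₂, s => e₁.eval s + e₂.eval s
  | sub e₁ e₂, s => e₁.eval s - e₂.eval s
  | mul e₁ e₂, s => e₁.eval s * e₂.eval s
  | pow e n, s => e.eval s ^ n

/-- The variables occurring in a term. -/
def vars : Term V → Set V
  | var x => {x}
  | const _ => ∅
  | neg e => e.vars
  | add e₁ e₂ => e₁.vars ∪ e₂.vars
  | sub e₁ e₂ => e₁.vars ∪ e₂.vars
  | mul e₁ e₂ => e₁.vars ∪ e₂.vars
  | pow e _ => e.vars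

/-- Replace the variable `x` by the term `θ`. -/
def subst [DecidableEq V] (x : V) (θ : Term V) : Term V → Term V
  | var y => if y = x then θ else var y
  | const r => const r
  | neg e => neg (subst x θ e)
  | add e₁ e₂ => add (subst x θ e₁) (subst x θ e₂)
  | sub e₁ e₂ => sub (subst x θ e₁) (subst x θ e₂)
  | mul e₁ e₂ => mul (subst x θ e₁) (subst x θ e₂)
  | pow e n => pow (subst x θ e) n

/-- Rename all variables by the permutation `σ`. -/
def rename (σ : Equiv.Perm V) : Term V → Term V
  | var y => var (σ y)
  | const r => const r
  | neg e => neg (e.rename σ)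
  | add e₁ e₂ => add (e₁.rename σ) (e₂.rename σ)
  | sub e₁ e₂ => sub (e₁.rename σ) (e₂.rename σ)
  | mul e₁ e₂ => mul (e₁.rename σ) (e₂.rename σ)
  | pow e n => pow (e.rename σ) n

end Term

/-! ### Differential equation systems -/

/-- A differential equation system `x₁' = θ₁, …, xₙ' = θₙ` with distinct left-hand sides. -/
structure ODE (V : Type*) where
  eqs : List (V × Term V)
  nodup : (eqs.map Prod.fst).Nodup

namespace ODE

variable {V : Type*}

/-- The variables that have a differential equation. -/
def vars (ode : ODE V) : Set V := {x | ∃ p ∈ ode.eqs, p.1 = x}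

/-- The variables occurring in the right-hand sides. -/
def rhsVars (ode : ODE V) : Set V := {x | ∃ p ∈ ode.eqs, x ∈ p.2.vars}

/-- The right-hand side of the equation of `x`; variables without an equation are constant. -/
def rhs [DecidableEq V] (ode : ODE V) (x : V) : Term V :=
  (ode.eqs.lookup x).getD (Term.const 0)

/-- Replace `x` by `θ` in all right-hand sides. -/
def subst [DecidableEq V] (x : V) (θ : Term V) (ode : ODE V) : ODE V where
  eqs := ode.eqs.map fun p => (p.1, Term.subst x θ p.2)
  nodup := by simpa [List.map_map, Function.comp_def] using ode.nodup

/-- Rename all variables by the permutation `σ`. -/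
def rename (σ : Equiv.Perm V) (ode : ODE V) : ODE V where
  eqs := ode.eqs.map fun p => (σ p.1, p.2.rename σ)
  nodup := by
    have h := ode.nodup.map σ.injective
    simpa [List.map_map, Function.comp_def] using h

end ODE

/-- The Lie derivative of a term along a differential equation system, i.e. its differential
after replacing each `x'` by the right-hand side of the equation of `x`. -/
def Term.lie {V : Type*} [DecidableEq V] (ode : ODE V) : Term V → Term V
  | .var x => ode.rhs x
  | .const _ => .const 0
  | .neg e => .neg (e.lie ode)
  | .add e₁ e₂ => .add (e₁.lie ode) (e₂.lie ode)
  | .sub e₁ e₂ => .sub (e₁.lie ode) (e₂.lie ode)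
  | .mul e₁ e₂ => .add (.mul (e₁.lie ode) e₂) (.mul e₁ (e₂.lie ode))
  | .pow e n => .mul (.mul (.const n) (.pow e (n - 1))) (e.lie ode)

/-! ### Formulas and hybrid programs -/

/-- The comparison operators `=, ≠, ≥, >, ≤, <`. -/
inductive Cmp where
  | eq | ne | ge | gt | le | lt

/-- The relation on the reals denoted by a comparison operator. -/
def Cmp.rel : Cmp → ℝ → ℝ → Prop
  | eq, a, b => a = b
  | ne, a, b => a ≠ b
  | ge, a, b => a ≥ b
  | gt, a, b => a > b
  | le, a, b => a ≤ b
  | lt, a, b => a < b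

mutual

/-- Formulas of differential dynamic logic. -/
inductive Formula (V : Type u) where
  | cmp (c : Cmp) (e₁ e₂ : Term V)
  | not (φ : Formula V)
  | and (φ ψ : Formula V)
  | or (φ ψ : Formula V)
  | imp (φ ψ : Formula V)
  | all (x : V) (φ : Formula V)
  | ex (x : V) (φ : Formula V)
  | box (α : Program V) (φ : Formula V)
  | dia (α : Program V) (φ : Formula V)

/-- Hybrid programs: `x := θ`, `x := *`, `?F`, `{x' = θ & F}`, `α ∪ β`, `α; β`, `α*`. -/
inductive Program (V : Type u) where
  | assign (x : V) (θ : Term V)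
  | random (x : V)
  | test (F : Formula V)
  | evolve (ode : ODE V) (F : Formula V)
  | choice (α β : Program V)
  | seq (α β : Program V)
  | star (α : Program V)

end

/-- Biimplication. -/
def Formula.iff {V : Type*} (φ ψ : Formula V) : Formula V := .and (.imp φ ψ) (.imp ψ φ)

/-- The false formula. -/
def Formula.falsum {V : Type*} : Formula V := .cmp .eq (.const 0) (.const 1)

/-! ### Semantics -/

mutual

/-- `φ.sat s` is `s ⊨ φ`. -/
def Formula.sat {V : Type*} [DecidableEq V] : Formula V → State V → Prop
  | .cmp c e₁ e₂, s => c.rel (e₁.eval s) (e₂.eval s)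
  | .not φ, s => ¬ φ.sat s
  | .and φ ψ, s => φ.sat s ∧ ψ.sat s
  | .or φ ψ, s => φ.sat s ∨ ψ.sat s
  | .imp φ ψ, s => φ.sat s → ψ.sat s
  | .all x φ, s => ∀ d : ℝ, φ.sat (Function.update s x d)
  | .ex x φ, s => ∃ d : ℝ, φ.sat (Function.update s x d)
  | .box α φ, s => ∀ t, α.den s t → φ.sat t
  | .dia α φ, s => ∃ t, α.den s t ∧ φ.sat t

/-- `α.den s t` is `(s, t) ∈ ⟦α⟧`: the state `t` is reachable by running `α` from `s`. A
continuous evolution follows a solution of the differential equations for some duration `r ≥ 0`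
inside its evolution domain; variables without a differential equation keep their values. -/
def Program.den {V : Type*} [DecidableEq V] : Program V → State V → State V → Prop
  | .assign x θ, s, t => t = Function.update s x (θ.eval s)
  | .random x, s, t => ∃ d : ℝ, t = Function.update s x d
  | .test F, s, t => t = s ∧ F.sat s
  | .evolve ode F, s, t => ∃ r : ℝ, 0 ≤ r ∧ ∃ f : ℝ → State V, f 0 = s ∧ f r = t ∧
      ∀ ζ ∈ Set.Icc 0 r,
        (∀ p ∈ ode.eqs,
          HasDerivWithinAt (fun τ => f τ p.1) (p.2.eval (f ζ)) (Set.Icc 0 r) ζ) ∧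
        (∀ x, x ∉ ode.vars → f ζ x = s x) ∧ F.sat (f ζ)
  | .choice α β, s, t => α.den s t ∨ β.den s t
  | .seq α β, s, t => ∃ u, α.den s u ∧ β.den u t
  | .star α, s, t => Relation.ReflTransGen (fun a b => α.den a b) s t

end

/-- A formula is valid if it is true in every state. -/
def Formula.Valid {V : Type*} [DecidableEq V] (φ : Formula V) : Prop := ∀ s, φ.sat s

/-! ### Static notions -/

mutual

/-- The number of modalities in a formula. -/
def Formula.modalities {V : Type*} : Formula V → ℕ
  | .cmp _ _ _ => 0
  | .not φ => φ.modalities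
  | .and φ ψ => φ.modalities + ψ.modalities
  | .or φ ψ => φ.modalities + ψ.modalities
  | .imp φ ψ => φ.modalities + ψ.modalities
  | .all _ φ => φ.modalities
  | .ex _ φ => φ.modalities
  | .box α φ => 1 + α.modalities + φ.modalities
  | .dia α φ => 1 + α.modalities + φ.modalities

/-- The number of modalities in the tests and evolution domains of a program. -/
def Program.modalities {V : Type*} : Program V → ℕ
  | .assign _ _ => 0
  | .random _ => 0
  | .test F => F.modalities
  | .evolve _ F => F.modalities
  | .choice α β => α.modalities + β.modalities
  | .seq α β => α.modalities + β.modalities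
  | .star α => α.modalities

end

/-- The program contains no repetition. -/
def Program.LoopFree {V : Type*} : Program V → Prop
  | .assign _ _ => True
  | .random _ => True
  | .test _ => True
  | .evolve _ _ => True
  | .choice α β => α.LoopFree ∧ β.LoopFree
  | .seq α β => α.LoopFree ∧ β.LoopFree
  | .star _ => False

/-- The variables that some run of the program may change. -/
def Program.bv {V : Type*} : Program V → Set V
  | .assign x _ => {x}
  | .random x => {x}
  | .test _ => ∅
  | .evolve ode _ => ode.vars
  | .choice α β => α.bv ∪ β.bv
  | .seq α β => α.bv ∪ β.bv
  | .star α => α.bv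

/-- The variables that are written on every run of the program. -/
def Program.mbv {V : Type*} : Program V → Set V
  | .assign x _ => {x}
  | .random x => {x}
  | .test _ => ∅
  | .evolve ode _ => ode.vars
  | .choice α β => α.mbv ∩ β.mbv
  | .seq α β => α.mbv ∪ β.mbv
  | .star _ => ∅

mutual

/-- Free variables of a formula. -/
def Formula.fv {V : Type*} : Formula V → Set V
  | .cmp _ e₁ e₂ => e₁.vars ∪ e₂.vars
  | .not φ => φ.fv
  | .and φ ψ => φ.fv ∪ ψ.fv
  | .or φ ψ => φ.fv ∪ ψ.fv
  | .imp φ ψ => φ.fv ∪ ψ.fv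
  | .all x φ => φ.fv \ {x}
  | .ex x φ => φ.fv \ {x}
  | .box α φ => α.fv ∪ (φ.fv \ α.mbv)
  | .dia α φ => α.fv ∪ (φ.fv \ α.mbv)

/-- Free variables of a program. -/
def Program.fv {V : Type*} : Program V → Set V
  | .assign _ θ => θ.vars
  | .random _ => ∅
  | .test F => F.fv
  | .evolve ode F => ode.vars ∪ ode.rhsVars ∪ F.fv
  | .choice α β => α.fv ∪ β.fv
  | .seq α β => α.fv ∪ (β.fv \ α.mbv)
  | .star α => α.fv

end

/-- `x` neither occurs free in `α` nor is written by `α`. -/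
def Program.Fresh {V : Type*} (x : V) (α : Program V) : Prop := x ∉ α.fv ∧ x ∉ α.bv

open Classical in
mutual

/-- Replace the free occurrences of `x` by `θ`; meaningful under `Formula.Admissible`. -/
noncomputable def Formula.subst {V : Type*} [DecidableEq V] (x : V) (θ : Term V) :
    Formula V → Formula V
  | .cmp c e₁ e₂ => .cmp c (Term.subst x θ e₁) (Term.subst x θ e₂)
  | .not φ => .not (φ.subst x θ)
  | .and φ ψ => .and (φ.subst x θ) (ψ.subst x θ)
  | .or φ ψ => .or (φ.subst x θ) (ψ.subst x θ)
  | .imp φ ψ => .imp (φ.subst x θ) (ψ.subst x θ)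
  | .all y φ => if x ∈ (Formula.all y φ).fv then .all y (φ.subst x θ) else .all y φ
  | .ex y φ => if x ∈ (Formula.ex y φ).fv then .ex y (φ.subst x θ) else .ex y φ
  | .box α φ => if x ∈ (Formula.box α φ).fv then .box (α.subst x θ) (φ.subst x θ) else .box α φ
  | .dia α φ => if x ∈ (Formula.dia α φ).fv then .dia (α.subst x θ) (φ.subst x θ) else .dia α φ

/-- Replace `x` by `θ` in a program; only used for programs that write neither `x` nor a variable
of `θ`. -/
noncomputable def Program.subst {V : Type*} [DecidableEq V] (x : V) (θ : Term V) :
    Program V → Program V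
  | .assign y η => .assign y (Term.subst x θ η)
  | .random y => .random y
  | .test F => .test (F.subst x θ)
  | .evolve ode F => .evolve (ode.subst x θ) (F.subst x θ)
  | .choice α β => .choice (α.subst x θ) (β.subst x θ)
  | .seq α β => .seq (α.subst x θ) (β.subst x θ)
  | .star α => .star (α.subst x θ)

end

mutual

/-- Replacing `x` by `θ` is admissible: no replacement happens in the scope of a quantifier or
modality that binds `x` or a variable of `θ`. -/
def Formula.Admissible {V : Type*} (x : V) (θ : Term V) : Formula V → Prop
  | .cmp _ _ _ => True
  | .not φ => φ.Admissible x θ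
  | .and φ ψ => φ.Admissible x θ ∧ ψ.Admissible x θ
  | .or φ ψ => φ.Admissible x θ ∧ ψ.Admissible x θ
  | .imp φ ψ => φ.Admissible x θ ∧ ψ.Admissible x θ
  | .all y φ => x ∉ (Formula.all y φ).fv ∨ (y ∉ θ.vars ∧ φ.Admissible x θ)
  | .ex y φ => x ∉ (Formula.ex y φ).fv ∨ (y ∉ θ.vars ∧ φ.Admissible x θ)
  | .box α φ => x ∉ (Formula.box α φ).fv ∨
      (x ∉ α.bv ∧ Disjoint θ.vars α.bv ∧ α.Admissible x θ ∧ φ.Admissible x θ)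
  | .dia α φ => x ∉ (Formula.dia α φ).fv ∨
      (x ∉ α.bv ∧ Disjoint θ.vars α.bv ∧ α.Admissible x θ ∧ φ.Admissible x θ)

/-- Replacing `x` by `θ` is admissible in all tests and evolution domains. -/
def Program.Admissible {V : Type*} (x : V) (θ : Term V) : Program V → Prop
  | .assign _ _ => True
  | .random _ => True
  | .test F => F.Admissible x θ
  | .evolve _ F => F.Admissible x θ
  | .choice α β => α.Admissible x θ ∧ β.Admissible x θ
  | .seq α β => α.Admissible x θ ∧ β.Admissible x θ
  | .star α => α.Admissible x θ

end

mutual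

/-- Rename all (free and bound) variables by the permutation `σ`. -/
def Formula.rename {V : Type*} (σ : Equiv.Perm V) : Formula V → Formula V
  | .cmp c e₁ e₂ => .cmp c (e₁.rename σ) (e₂.rename σ)
  | .not φ => .not (φ.rename σ)
  | .and φ ψ => .and (φ.rename σ) (ψ.rename σ)
  | .or φ ψ => .or (φ.rename σ) (ψ.rename σ)
  | .imp φ ψ => .imp (φ.rename σ) (ψ.rename σ)
  | .all y φ => .all (σ y) (φ.rename σ)
  | .ex y φ => .ex (σ y) (φ.rename σ)
  | .box α φ => .box (α.rename σ) (φ.rename σ)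
  | .dia α φ => .dia (α.rename σ) (φ.rename σ)

/-- Rename all variables by the permutation `σ`. -/
def Program.rename {V : Type*} (σ : Equiv.Perm V) : Program V → Program V
  | .assign y η => .assign (σ y) (η.rename σ)
  | .random y => .random (σ y)
  | .test F => .test (F.rename σ)
  | .evolve ode F => .evolve (ode.rename σ) (F.rename σ)
  | .choice α β => .choice (α.rename σ) (β.rename σ)
  | .seq α β => .seq (α.rename σ) (β.rename σ)
  | .star α => .star (α.rename σ)

end

/-- Propositional evaluation: `v` gives the truth values of comparisons, quantified formulas and
modal formulas. -/
def Formula.propEval {V : Type*} (v : Formula V → Prop) : Formula V → Prop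
  | .not φ => ¬ φ.propEval v
  | .and φ ψ => φ.propEval v ∧ ψ.propEval v
  | .or φ ψ => φ.propEval v ∨ ψ.propEval v
  | .imp φ ψ => φ.propEval v → ψ.propEval v
  | φ => v φ

/-- The differential of a formula along a differential equation system, as used by differential
invariants. It is defined for conjunctions and disjunctions of comparisons; for any other formula
it is false, so that the differential invariant axiom says nothing of interest about it. -/
def Formula.lie {V : Type*} [DecidableEq V] (ode : ODE V) : Formula V → Formula V
  | .cmp .eq e₁ e₂ => .cmp .eq (e₁.lie ode) (e₂.lie ode)
  | .cmp .ne e₁ e₂ => .cmp .eq (e₁.lie ode) (e₂.lie ode)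
  | .cmp .ge e₁ e₂ => .cmp .ge (e₁.lie ode) (e₂.lie ode)
  | .cmp .gt e₁ e₂ => .cmp .ge (e₁.lie ode) (e₂.lie ode)
  | .cmp .le e₁ e₂ => .cmp .le (e₁.lie ode) (e₂.lie ode)
  | .cmp .lt e₁ e₂ => .cmp .le (e₁.lie ode) (e₂.lie ode)
  | .and φ ψ => .and (φ.lie ode) (ψ.lie ode)
  | .or φ ψ => .and (φ.lie ode) (ψ.lie ode)
  | _ => .falsum

/-! ### Proof calculus -/

/-- `Provable φ` is `⊢ φ`: the Hilbert calculus of differential dynamic logic, over first-order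
logic and first-order real arithmetic (whose valid formulas are axioms, as usual). -/
inductive Provable {V : Type*} [DecidableEq V] : Formula V → Prop
  -- rules: modus ponens, generalization over variables and over programs
  | mp {φ ψ : Formula V} : Provable (.imp φ ψ) → Provable φ → Provable ψ
  | gen {φ : Formula V} (x : V) : Provable φ → Provable (.all x φ)
  | goedel {φ : Formula V} (α : Program V) : Provable φ → Provable (.box α φ)
  -- propositional tautologies, real arithmetic, quantifiers
  | taut (φ : Formula V) : (∀ v, φ.propEval v) → Provable φ
  | arith (φ : Formula V) : φ.modalities = 0 → φ.Valid → Provable φ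
  | allInst (x : V) (θ : Term V) (φ : Formula V) :
      Provable (.imp (.all x φ) (.box (.assign x θ) φ))
  | allDist (x : V) (φ ψ : Formula V) :
      Provable (.imp (.all x (.imp φ ψ)) (.imp (.all x φ) (.all x ψ)))
  | allVacuous (x : V) (φ : Formula V) : x ∉ φ.fv → Provable (.imp φ (.all x φ))
  | exDual (x : V) (φ : Formula V) : Provable (.iff (.ex x φ) (.not (.all x (.not φ))))
  -- `⟨α⟩φ ↔ ¬[α]¬φ`
  | diaDual (α : Program V) (φ : Formula V) :
      Provable (.iff (.dia α φ) (.not (.box α (.not φ))))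
  -- `[x := θ]φ ↔ φ(θ)`
  | assign (x : V) (θ : Term V) (φ : Formula V) : φ.Admissible x θ →
      Provable (.iff (.box (.assign x θ) φ) (φ.subst x θ))
  -- `[x := θ]φ ↔ ∀x (x = θ → φ)`
  | assignEq (x : V) (θ : Term V) (φ : Formula V) : x ∉ θ.vars →
      Provable (.iff (.box (.assign x θ) φ) (.all x (.imp (.cmp .eq (.var x) θ) φ)))
  -- `x = θ → ([x := θ]φ ↔ φ)`
  | assignSelf (x : V) (θ : Term V) (φ : Formula V) :
      Provable (.imp (.cmp .eq (.var x) θ) (.iff (.box (.assign x θ) φ) φ))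
  -- bound renaming
  | boundRename (x y : V) (θ : Term V) (φ : Formula V) : y ∉ φ.fv →
      Provable (.iff (.box (.assign x θ) φ)
        (.box (.assign y θ) (φ.rename (Equiv.swap x y))))
  | random (x : V) (φ : Formula V) : Provable (.iff (.box (.random x) φ) (.all x φ))
  | test (F φ : Formula V) : Provable (.iff (.box (.test F) φ) (.imp F φ))
  | choice (α β : Program V) (φ : Formula V) :
      Provable (.iff (.box (.choice α β) φ) (.and (.box α φ) (.box β φ)))
  | seq (α β : Program V) (φ : Formula V) :
      Provable (.iff (.box (.seq α β) φ) (.box α (.box β φ)))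
  | iterate (α : Program V) (φ : Formula V) :
      Provable (.iff (.box (.star α) φ) (.and φ (.box α (.box (.star α) φ))))
  | modalK (α : Program V) (φ ψ : Formula V) :
      Provable (.imp (.box α (.imp φ ψ)) (.imp (.box α φ) (.box α ψ)))
  -- `[α*](φ → [α]φ) → (φ → [α*]φ)`
  | induction (α : Program V) (φ : Formula V) :
      Provable (.imp (.box (.star α) (.imp φ (.box α φ))) (.imp φ (.box (.star α) φ)))
  -- `[α*]∀v (v > 0 → (φ(v) → ⟨α⟩φ(v - 1))) → ∀v (φ(v) → ⟨α*⟩∃v (v ≤ 0 ∧ φ(v)))`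
  | convergence (α : Program V) (v : V) (φ : Formula V) : α.Fresh v →
      Provable (.imp
        (.box (.star α) (.all v (.imp (.cmp .gt (.var v) (.const 0))
          (.imp φ (.dia α (.box (.assign v (.sub (.var v) (.const 1))) φ))))))
        (.all v (.imp φ (.dia (.star α)
          (.ex v (.and (.cmp .le (.var v) (.const 0)) φ))))))
  | barcan (α : Program V) (x : V) (φ : Formula V) : α.Fresh x →
      Provable (.imp (.all x (.box α φ)) (.box α (.all x φ)))
  | vacuous (α : Program V) (φ : Formula V) : Disjoint φ.fv α.bv → Provable (.imp φ (.box α φ))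
  -- differential weakening
  | diffWeaken (ode : ODE V) (F : Formula V) : Provable (.box (.evolve ode F) F)
  -- differential cut
  | diffCut (ode : ODE V) (F C φ : Formula V) :
      Provable (.imp (.box (.evolve ode F) C)
        (.iff (.box (.evolve ode F) φ) (.box (.evolve ode (.and F C)) φ)))
  -- differential invariant: `(F → [x' = θ & F](φ)') → ([x' = θ & F]φ ↔ [?F]φ)`
  | diffInv (ode : ODE V) (F φ : Formula V) :
      Provable (.imp (.imp F (.box (.evolve ode F) (φ.lie ode)))
        (.iff (.box (.evolve ode F) φ) (.box (.test F) φ)))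
  -- differential ghost: `[x' = θ & F]φ ↔ ∃y [y' = a * y + b, x' = θ & F]φ` with `y` fresh
  | diffGhost (ode ode' : ODE V) (F φ : Formula V) (y : V) (a b : Term V) :
      ode'.eqs = (y, .add (.mul a (.var y)) b) :: ode.eqs →
      y ∉ ode.rhsVars → y ∉ F.fv → y ∉ φ.fv → y ∉ a.vars → y ∉ b.vars →
      Provable (.iff (.box (.evolve ode F) φ) (.ex y (.box (.evolve ode' F) φ)))
  -- differential solution:
  -- `[x' = c & F]φ ↔ ∀t≥0 ((∀r (0 ≤ r ≤ t → [x := x + c * r]F)) → [x := x + c * t]φ)`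
  | diffSolve (ode : ODE V) (F φ : Formula V) (x t r : V) (c : Term V) :
      ode.eqs = [(x, c)] → t ≠ x → r ≠ x → t ≠ r → x ∉ c.vars → t ∉ c.vars → r ∉ c.vars →
      t ∉ F.fv → r ∉ F.fv → t ∉ φ.fv →
      Provable (.iff (.box (.evolve ode F) φ)
        (.all t (.imp (.cmp .ge (.var t) (.const 0))
          (.imp
            (.all r (.imp (.and (.cmp .le (.const 0) (.var r)) (.cmp .le (.var r) (.var t)))
              (.box (.assign x (.add (.var x) (.mul c (.var r)))) F)))
            (.box (.assign x (.add (.var x) (.mul c (.var t)))) φ)))))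
  -- congruences inside continuous evolutions: order of equations, domains, right-hand sides
  | diffPerm (ode ode' : ODE V) (F φ : Formula V) : ode.eqs.Perm ode'.eqs →
      Provable (.imp (.box (.evolve ode F) φ) (.box (.evolve ode' F) φ))
  | diffRefine (ode : ODE V) (F G φ : Formula V) : Provable (.imp G F) →
      Provable (.imp (.box (.evolve ode F) φ) (.box (.evolve ode G) φ))
  | diffCongr (ode ode' : ODE V) (F φ : Formula V) (l₁ l₂ : List (V × Term V)) (x : V)
      (θ η : Term V) : ode.eqs = l₁ ++ (x, θ) :: l₂ → ode'.eqs = l₁ ++ (x, η) :: l₂ →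
      Provable (.imp F (.cmp .eq θ η)) →
      Provable (.imp (.box (.evolve ode F) φ) (.box (.evolve ode' F) φ))

/-! ### Monitored models and μlearning -/

/-- An action: a mapping from variables to terms, i.e. a simultaneous assignment. -/
abbrev Action (V : Type*) := V → Term V

/-- `a.apply s` is `a(s)`, the effect of taking the action `a` in the state `s`. -/
def Action.apply {V : Type*} (a : Action V) (s : State V) : State V := fun x => (a x).eval s

/-- The formula `init → [{ctrl; plant}*] safe`. -/
def modelFormula {V : Type*} (init : Formula V) (ctrl plant : Program V) (safe : Formula V) :
    Formula V :=
  .imp init (.box (.star (.seq ctrl plant)) safe)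

/-- A monitored model: a formula `init → [{ctrl; plant}*] safe` with loop-free `ctrl` and exactly
one modality, a controller monitor `cm` and a model monitor `mm`. -/
structure MonitoredModel (V : Type*) [DecidableEq V] where
  init : Formula V
  ctrl : Program V
  plant : Program V
  safe : Formula V
  cm : State V → Action V → Bool
  mm : State V → Action V → State V → Bool
  ctrl_loopFree : ctrl.LoopFree
  one_modality : (modelFormula init ctrl plant safe).modalities = 1
  cm_sound : ∀ s a, cm s a = true → ctrl.den s (a.apply s)
  mm_sound : ∀ s a t, mm s a t = true → ctrl.den s (a.apply s) ∧ plant.den (a.apply s) t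

/-- The formula `init → [{ctrl; plant}*] safe` of a monitored model. -/
def MonitoredModel.formula {V : Type*} [DecidableEq V] (m : MonitoredModel V) : Formula V :=
  modelFormula m.init m.ctrl m.plant m.safe

/-- Finite or infinite sequences of actions `U`, states `S` and sets of monitored models `Mon`.
`length` is `|S|`; only the values `S i` and `Mon i` with `i < length`, and `U i` with
`i + 1 < length` (the actions leading from a visited state to the next one) matter. -/
structure Trace (V : Type*) [DecidableEq V] where
  length : ℕ∞
  U : ℕ → Action V
  S : ℕ → State V
  Mon : ℕ → Set (MonitoredModel V)

/-- The action `U i` is permitted by the controller monitor of `m`, or `m` has been falsified by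
the last transition; always true for `i = 0`. -/
def specOK {V : Type*} [DecidableEq V] (m : MonitoredModel V) (U : ℕ → Action V)
    (S : ℕ → State V) (i : ℕ) : Prop :=
  i = 0 ∨ m.cm (S i) (U i) = true ∨ ¬ m.mm (S (i - 1)) (U (i - 1)) (S i) = true

/-- `P` is a μlearning process over the finite set `A` of actions, for the finite set `M` of
monitored models, in the environment `E`. -/
structure IsMuLearning {V : Type*} [DecidableEq V] (A : Set (Action V))
    (M : Set (MonitoredModel V)) (E : Action V → State V → State V) (P : Trace V) : Prop where
  finite_actions : A.Finite
  finite_models : M.Finite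
  mon_zero : P.Mon 0 = M
  action_mem : ∀ i : ℕ, ((i + 1 : ℕ) : ℕ∞) < P.length → P.U i ∈ A
  env : ∀ i : ℕ, ((i + 1 : ℕ) : ℕ∞) < P.length → P.S (i + 1) = E (P.U i) (P.S i)
  /-- Action availability. -/
  available : ∀ i : ℕ, (i : ℕ∞) < P.length →
    ∃ u ∈ A, ∀ m ∈ P.Mon i, specOK m (Function.update P.U i u) P.S i
  /-- Actions are safe for all feasible models. -/
  actions_safe : ∀ i : ℕ, ((i + 1 : ℕ) : ℕ∞) < P.length →
    ∀ m ∈ P.Mon i, m.cm (P.S i) (P.U i) = true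
  /-- Feasible models remain in the feasible set. -/
  feasible_remain : ∀ i : ℕ, ((i + 1 : ℕ) : ℕ∞) < P.length →
    ∀ m ∈ P.Mon i, m.mm (P.S i) (P.U i) (P.S (i + 1)) = true → m ∈ P.Mon (i + 1)

/-- `m` is an accurate model for the process `P` in the environment `E`. -/
structure IsAccurate {V : Type*} [DecidableEq V] (A : Set (Action V))
    (E : Action V → State V → State V) (P : Trace V) (m : MonitoredModel V) : Prop where
  mem : m ∈ P.Mon 0
  provable : Provable m.formula
  /-- The environment realises the plant. -/
  realises : ∀ u ∈ A, ∀ s, m.ctrl.den s (u.apply s) → m.plant.den (u.apply s) (E u s)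
  /-- The process starts in an initial state of the model. -/
  initial : m.init.sat (P.S 0)
  /-- The model monitor is exact: it accepts every transition that the model explains. -/
  mm_complete : ∀ u ∈ A, ∀ s t, m.ctrl.den s (u.apply s) → m.plant.den (u.apply s) t →
    m.mm s u t = true

end DL

/-!
The argument has two independent halves.

Soundness of the calculus (`Provable.valid`): every provable formula is true in every state. The
syntactic side conditions of the axioms are justified by four facts about the semantics, each proved
by structural induction on formulas and programs: a run changes only bound variables
(`Program.den_eq_of_notMem_bv`), truth and runs depend on free variables only (`Formula.sat_congr`,
`Program.den_congr`), renaming variables amounts to permuting the state (`Formula.sat_rename`,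
`Program.den_rename`), and an admissible substitution of `θ` for `x` amounts to storing the value of
`θ` in `x` (`Formula.sat_subst`, `Program.den_subst`). The axioms for differential equations are
facts about flows: Lie derivatives are time derivatives, so that differential invariants follow from
the mean value theorem (`ODE.IsFlow.sat_of_lie`); linear ghost equations are solvable for all times
by variation of constants (`ODE.IsFlow.exists_ghost`); an equation with constant right-hand side has
exactly the linear solution (`ODE.IsFlow.eq_of_const_rhs`).

Reachability (`IsAccurate.mem_mon_and_reachable`): while the accurate model is feasible, its
controller monitor accepts the action taken, so the action is a run of the model's controller; the
environment realises its plant, so the transition is a run of the loop body; the model monitor is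
exact, so it accepts the transition and the model remains feasible. Hence every state of the process
is reachable by the loop of the model from the initial state, and the validity of
`init → [{ctrl; plant}*] safe` makes it safe.
-/

namespace DL

/-! ### Coincidence and bound effect -/

section Coincidence

variable {V : Type*}

theorem Term.eval_congr {s s' : State V} :
    (e : Term V) → Set.EqOn s s' e.vars → e.eval s = e.eval s'
  | .var _, h => h rfl
  | .const _, _ => rfl
  | .neg e, h => congrArg (- ·) (Term.eval_congr e h)
  | .add e₁ e₂, h => congrArg₂ (· + ·) (Term.eval_congr e₁ fun _ hx => h (.inl hx))
      (Term.eval_congr e₂ fun _ hx => h (.inr hx))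
  | .sub e₁ e₂, h => congrArg₂ (· - ·) (Term.eval_congr e₁ fun _ hx => h (.inl hx))
      (Term.eval_congr e₂ fun _ hx => h (.inr hx))
  | .mul e₁ e₂, h => congrArg₂ (· * ·) (Term.eval_congr e₁ fun _ hx => h (.inl hx))
      (Term.eval_congr e₂ fun _ hx => h (.inr hx))
  | .pow e n, h => congrArg (· ^ n) (Term.eval_congr e h)

theorem Program.Fresh.star {x : V} {α : Program V} (hx : α.Fresh x) : (Program.star α).Fresh x := by
  simpa only [Program.Fresh, Program.fv, Program.bv] using hx

variable [DecidableEq V]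

theorem Term.eval_update_of_notMem {x : V} {e : Term V} (hx : x ∉ e.vars) (s : State V) (d : ℝ) :
    e.eval (Function.update s x d) = e.eval s :=
  e.eval_congr fun _ hy => Function.update_of_ne (ne_of_mem_of_not_mem hy hx) _ _

/-- `f` restricted to `[0, r]` is a continuous evolution from `s` along `ode` within `F`. -/
structure ODE.IsFlow (ode : ODE V) (F : Formula V) (s : State V) (r : ℝ) (f : ℝ → State V) :
    Prop where
  nonneg : 0 ≤ r
  zero : f 0 = s
  deriv : ∀ ζ ∈ Set.Icc 0 r, ∀ p ∈ ode.eqs,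
    HasDerivWithinAt (fun τ => f τ p.1) (p.2.eval (f ζ)) (Set.Icc 0 r) ζ
  const : ∀ ζ ∈ Set.Icc 0 r, ∀ x, x ∉ ode.vars → f ζ x = s x
  domain : ∀ ζ ∈ Set.Icc 0 r, F.sat (f ζ)

theorem Program.den_evolve_iff {ode : ODE V} {F : Formula V} {s t : State V} :
    (Program.evolve ode F).den s t ↔ ∃ r f, ode.IsFlow F s r f ∧ f r = t := by
  simp only [Program.den]
  constructor
  · rintro ⟨r, hr, f, h0, ht, h⟩
    exact ⟨r, f, ⟨hr, h0, fun ζ hζ => (h ζ hζ).1, fun ζ hζ => (h ζ hζ).2.1,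
      fun ζ hζ => (h ζ hζ).2.2⟩, ht⟩
  · rintro ⟨r, f, h, ht⟩
    exact ⟨r, h.nonneg, f, h.zero, ht, fun ζ hζ => ⟨h.deriv ζ hζ, h.const ζ hζ, h.domain ζ hζ⟩⟩

theorem ODE.IsFlow.den {ode : ODE V} {F : Formula V} {s : State V} {r : ℝ} {f : ℝ → State V}
    (h : ode.IsFlow F s r f) : (Program.evolve ode F).den s (f r) :=
  Program.den_evolve_iff.2 ⟨r, f, h, rfl⟩

/-- A run of a program changes none but its bound variables. -/
theorem Program.den_eq_of_notMem_bv {x : V} : (α : Program V) → {s t : State V} →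
    α.den s t → x ∉ α.bv → t x = s x
  | .assign y θ, s, t, h, hx => by
      simp only [Program.den] at h
      subst h
      exact Function.update_of_ne hx _ _
  | .random y, s, t, h, hx => by
      simp only [Program.den] at h
      obtain ⟨d, rfl⟩ := h
      exact Function.update_of_ne hx _ _
  | .test F, s, t, h, _ => by
      simp only [Program.den] at h
      rw [h.1]
  | .evolve ode F, s, t, h, hx => by
      obtain ⟨r, f, hf, rfl⟩ := Program.den_evolve_iff.1 h
      exact hf.const r ⟨hf.nonneg, le_rfl⟩ x hx
  | .choice α β, s, t, h, hx => by
      simp only [Program.den] at h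
      exact h.elim (fun h => α.den_eq_of_notMem_bv h fun hb => hx (.inl hb))
        (fun h => β.den_eq_of_notMem_bv h fun hb => hx (.inr hb))
  | .seq α β, s, t, h, hx => by
      simp only [Program.den] at h
      obtain ⟨u, h₁, h₂⟩ := h
      exact (β.den_eq_of_notMem_bv h₂ fun hb => hx (.inr hb)).trans
        (α.den_eq_of_notMem_bv h₁ fun hb => hx (.inl hb))
  | .star α, s, t, h, hx => by
      simp only [Program.den] at h
      induction h with
      | refl => rfl
      | tail _ h ih => exact (α.den_eq_of_notMem_bv h hx).trans ih

mutual

/-- The truth of a formula depends on its free variables only. -/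
theorem Formula.sat_congr : (φ : Formula V) → {s s' : State V} → Set.EqOn s s' φ.fv →
    (φ.sat s ↔ φ.sat s')
  | .cmp c e₁ e₂, s, s', h => by
      simp only [Formula.sat, Formula.fv] at *
      rw [e₁.eval_congr fun _ hx => h (.inl hx), e₂.eval_congr fun _ hx => h (.inr hx)]
  | .not φ, s, s', h => by
      simp only [Formula.sat, Formula.fv] at *
      rw [φ.sat_congr h]
  | .and φ ψ, s, s', h => by
      simp only [Formula.sat, Formula.fv] at *
      rw [φ.sat_congr fun _ hx => h (.inl hx), ψ.sat_congr fun _ hx => h (.inr hx)]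
  | .or φ ψ, s, s', h => by
      simp only [Formula.sat, Formula.fv] at *
      rw [φ.sat_congr fun _ hx => h (.inl hx), ψ.sat_congr fun _ hx => h (.inr hx)]
  | .imp φ ψ, s, s', h => by
      simp only [Formula.sat, Formula.fv] at *
      rw [φ.sat_congr fun _ hx => h (.inl hx), ψ.sat_congr fun _ hx => h (.inr hx)]
  | .all x φ, s, s', h => by
      simp only [Formula.sat, Formula.fv] at *
      refine forall_congr' fun d => φ.sat_congr fun y hy => ?_
      by_cases hyx : y = x
      · subst hyx; simp
      · simpa [hyx] using h ⟨hy, hyx⟩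
  | .ex x φ, s, s', h => by
      simp only [Formula.sat, Formula.fv] at *
      refine exists_congr fun d => φ.sat_congr fun y hy => ?_
      by_cases hyx : y = x
      · subst hyx; simp
      · simpa [hyx] using h ⟨hy, hyx⟩
  | .box α φ, s, s', h => by
      simp only [Formula.sat, Formula.fv] at *
      have key : ∀ {s s' : State V}, Set.EqOn s s' (α.fv ∪ (φ.fv \ α.mbv)) →
          (∀ t, α.den s t → φ.sat t) → ∀ t, α.den s' t → φ.sat t := by
        intro s s' h H t ht
        obtain ⟨t', ht', he⟩ := α.den_congr Set.subset_union_left h.symm ht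
        refine (φ.sat_congr fun y hy => ?_).2 (H t' ht')
        by_cases hm : y ∈ α.mbv
        · exact he (.inr hm)
        · exact he (.inl (.inr ⟨hy, hm⟩))
      exact ⟨key h, key h.symm⟩
  | .dia α φ, s, s', h => by
      simp only [Formula.sat, Formula.fv] at *
      have key : ∀ {s s' : State V}, Set.EqOn s s' (α.fv ∪ (φ.fv \ α.mbv)) →
          (∃ t, α.den s t ∧ φ.sat t) → ∃ t, α.den s' t ∧ φ.sat t := by
        rintro s s' h ⟨t, ht, hφ⟩
        obtain ⟨t', ht', he⟩ := α.den_congr Set.subset_union_left h ht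
        refine ⟨t', ht', (φ.sat_congr fun y hy => ?_).1 hφ⟩
        by_cases hm : y ∈ α.mbv
        · exact he (.inr hm)
        · exact he (.inl (.inr ⟨hy, hm⟩))
      exact ⟨key h, key h.symm⟩

/-- A run can be repeated from a state that agrees with the initial one on a set `A` containing
the free variables; the final states then agree on `A` and on all variables that are certainly
written. -/
theorem Program.den_congr : (α : Program V) → {A : Set V} → {s s' t : State V} → α.fv ⊆ A →
    Set.EqOn s s' A → α.den s t → ∃ t', α.den s' t' ∧ Set.EqOn t t' (A ∪ α.mbv)
  | .assign x θ, A, s, s', t, hA, h, ht => by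
      simp only [Program.den, Program.fv, Program.mbv] at *
      subst ht
      refine ⟨_, rfl, fun y hy => ?_⟩
      by_cases hyx : y = x
      · subst hyx
        simpa using θ.eval_congr (h.mono hA)
      · simpa [hyx] using h (hy.resolve_right hyx)
  | .random x, A, s, s', t, hA, h, ht => by
      simp only [Program.den, Program.fv, Program.mbv] at *
      obtain ⟨d, rfl⟩ := ht
      refine ⟨_, ⟨d, rfl⟩, fun y hy => ?_⟩
      by_cases hyx : y = x
      · subst hyx
        simp
      · simpa [hyx] using h (hy.resolve_right hyx)
  | .test F, A, s, s', t, hA, h, ht => by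
      simp only [Program.den, Program.fv, Program.mbv] at *
      obtain ⟨rfl, hF⟩ := ht
      exact ⟨s', ⟨rfl, (F.sat_congr (h.mono hA)).1 hF⟩, by simpa using h⟩
  | .evolve ode F, A, s, s', t, hA, h, ht => by
      classical
      obtain ⟨r, f, hf, rfl⟩ := Program.den_evolve_iff.1 ht
      simp only [Program.fv, Program.mbv] at *
      -- the same flow, with the variables without an equation kept as in `s'`
      let g : ℝ → State V := fun τ y => if y ∈ ode.vars then f τ y else s' y
      have hg : ∀ ζ ∈ Set.Icc 0 r, Set.EqOn (f ζ) (g ζ) (A ∪ ode.vars) := by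
        intro ζ hζ y hy
        by_cases hv : y ∈ ode.vars
        · simp [g, hv]
        · simpa [g, hv, hf.const ζ hζ y hv] using h (hy.resolve_right hv)
      have hfv : ∀ p ∈ ode.eqs, p.2.vars ⊆ A ∪ ode.vars := fun p hp y hy =>
        .inl (hA (.inl (.inr ⟨p, hp, hy⟩)))
      have hflow : ode.IsFlow F s' r g := by
        refine ⟨hf.nonneg, ?_, fun ζ hζ p hp => ?_, fun ζ _ y hy => if_neg hy, fun ζ hζ => ?_⟩
        · funext y
          by_cases hv : y ∈ ode.vars
          · simpa [g, hv, hf.zero] using h (hA (.inl (.inl hv)))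
          · simp [g, hv]
        · have hv : p.1 ∈ ode.vars := ⟨p, hp, rfl⟩
          rw [← p.2.eval_congr ((hg ζ hζ).mono (hfv p hp))]
          simpa [g, hv] using hf.deriv ζ hζ p hp
        · exact (F.sat_congr ((hg ζ hζ).mono fun y hy => .inl (hA (.inr hy)))).1
            (hf.domain ζ hζ)
      exact ⟨g r, hflow.den, hg r ⟨hf.nonneg, le_rfl⟩⟩
  | .choice α β, A, s, s', t, hA, h, ht => by
      simp only [Program.den, Program.fv, Program.mbv] at *
      rcases ht with ht | ht
      · obtain ⟨t', ht', he⟩ := α.den_congr (fun _ hx => hA (.inl hx)) h ht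
        exact ⟨t', .inl ht', he.mono (Set.union_subset_union_right _ Set.inter_subset_left)⟩
      · obtain ⟨t', ht', he⟩ := β.den_congr (fun _ hx => hA (.inr hx)) h ht
        exact ⟨t', .inr ht', he.mono (Set.union_subset_union_right _ Set.inter_subset_right)⟩
  | .seq α β, A, s, s', t, hA, h, ht => by
      simp only [Program.den, Program.fv, Program.mbv] at *
      obtain ⟨u, hu, ht⟩ := ht
      obtain ⟨u', hu', he⟩ := α.den_congr (fun _ hx => hA (.inl hx)) h hu
      have hβ : β.fv ⊆ A ∪ α.mbv := fun y hy => by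
        by_cases hm : y ∈ α.mbv
        · exact .inr hm
        · exact .inl (hA (.inr ⟨hy, hm⟩))
      obtain ⟨t', ht', he'⟩ := β.den_congr hβ he ht
      exact ⟨t', ⟨u', hu', ht'⟩, by rwa [← Set.union_assoc]⟩
  | .star α, A, s, s', t, hA, h, ht => by
      simp only [Program.den, Program.fv, Program.mbv, Set.union_empty] at *
      induction ht with
      | refl => exact ⟨s', .refl, h⟩
      | tail _ hstep ih =>
        obtain ⟨u', hu', he⟩ := ih
        obtain ⟨t', ht', he'⟩ := α.den_congr hA he hstep
        exact ⟨t', hu'.tail ht', he'.mono Set.subset_union_left⟩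

end

theorem Formula.sat_update_of_notMem {x : V} {φ : Formula V} (hx : x ∉ φ.fv) (s : State V)
    (d : ℝ) : φ.sat (Function.update s x d) ↔ φ.sat s :=
  φ.sat_congr fun _ hy => Function.update_of_ne (ne_of_mem_of_not_mem hy hx) _ _

/-- A program ignores the value of a fresh variable and passes it on. -/
theorem Program.Fresh.den_update {x : V} {α : Program V} (hx : α.Fresh x) {s t : State V}
    (h : α.den s t) (d : ℝ) : α.den (Function.update s x d) (Function.update t x d) := by
  obtain ⟨t', ht', he⟩ := α.den_congr (A := {x}ᶜ) (s' := Function.update s x d)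
    (fun y hy hyx => hx.1 (hyx ▸ hy)) (fun y hy => (Function.update_of_ne hy _ _).symm) h
  convert ht'
  funext y
  by_cases hyx : y = x
  · subst hyx
    simpa using (α.den_eq_of_notMem_bv ht' hx.2).symm
  · simpa [hyx] using he (.inl hyx)

end Coincidence

/-! ### Renaming and substitution -/

section Substitution

variable {V : Type*}

theorem Term.eval_rename (σ : Equiv.Perm V) (s : State V) :
    (e : Term V) → (e.rename σ).eval s = e.eval (s ∘ σ)
  | .var _ => rfl
  | .const _ => rfl
  | .neg e => congrArg (- ·) (Term.eval_rename σ s e)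
  | .add e₁ e₂ => congrArg₂ (· + ·) (Term.eval_rename σ s e₁) (Term.eval_rename σ s e₂)
  | .sub e₁ e₂ => congrArg₂ (· - ·) (Term.eval_rename σ s e₁) (Term.eval_rename σ s e₂)
  | .mul e₁ e₂ => congrArg₂ (· * ·) (Term.eval_rename σ s e₁) (Term.eval_rename σ s e₂)
  | .pow e n => congrArg (· ^ n) (Term.eval_rename σ s e)

theorem ODE.mem_vars_rename {σ : Equiv.Perm V} {ode : ODE V} {x : V} :
    σ x ∈ (ode.rename σ).vars ↔ x ∈ ode.vars := by
  simp [ODE.vars, ODE.rename]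

theorem ODE.vars_eq_of_map_fst {ode ode' : ODE V}
    (h : ode.eqs.map Prod.fst = ode'.eqs.map Prod.fst) : ode.vars = ode'.vars := by
  ext x
  have h' : x ∈ ode.eqs.map Prod.fst ↔ x ∈ ode'.eqs.map Prod.fst := by rw [h]
  simpa only [ODE.vars, List.mem_map, Set.mem_ofPred_eq] using h'

variable [DecidableEq V]

theorem ODE.vars_subst (x : V) (θ : Term V) (ode : ODE V) : (ode.subst x θ).vars = ode.vars :=
  ODE.vars_eq_of_map_fst (by simp [ODE.subst])

theorem update_comp_perm (σ : Equiv.Perm V) (s : State V) (x : V) (d : ℝ) :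
    Function.update s (σ x) d ∘ σ = Function.update (s ∘ σ) x d :=
  Function.update_comp_eq_of_injective s σ.injective x d

/-- A renamed system flows as the original one does on renamed states. -/
theorem ODE.isFlow_rename_iff {σ : Equiv.Perm V} {ode : ODE V} {F : Formula V}
    (hF : ∀ s, (F.rename σ).sat s ↔ F.sat (s ∘ σ)) {s : State V} {r : ℝ} {f : ℝ → State V} :
    (ode.rename σ).IsFlow (F.rename σ) s r f ↔ ode.IsFlow F (s ∘ σ) r (fun τ => f τ ∘ σ) := by
  constructor
  · intro h
    refine ⟨h.nonneg, by rw [h.zero], fun ζ hζ p hp => ?_, fun ζ hζ x hx => ?_,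
      fun ζ hζ => (hF _).1 (h.domain ζ hζ)⟩
    · rw [← Term.eval_rename]
      exact h.deriv ζ hζ (σ p.1, p.2.rename σ) (List.mem_map_of_mem hp)
    · exact h.const ζ hζ _ (mt ODE.mem_vars_rename.1 hx)
  · intro h
    refine ⟨h.nonneg, ?_, fun ζ hζ q hq => ?_, fun ζ hζ x hx => ?_,
      fun ζ hζ => (hF _).2 (h.domain ζ hζ)⟩
    · exact σ.surjective.injective_comp_right h.zero
    · obtain ⟨p, hp, rfl⟩ := List.mem_map.1 hq
      rw [Term.eval_rename]
      exact h.deriv ζ hζ p hp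
    · obtain ⟨y, rfl⟩ := σ.surjective x
      exact h.const ζ hζ y (mt ODE.mem_vars_rename.2 hx)

mutual

theorem Formula.sat_rename (σ : Equiv.Perm V) : (φ : Formula V) → (s : State V) →
    ((φ.rename σ).sat s ↔ φ.sat (s ∘ σ))
  | .cmp c e₁ e₂, s => by simp only [Formula.rename, Formula.sat, Term.eval_rename]
  | .not φ, s => by simp only [Formula.rename, Formula.sat, φ.sat_rename σ]
  | .and φ ψ, s => by simp only [Formula.rename, Formula.sat, φ.sat_rename σ, ψ.sat_rename σ]
  | .or φ ψ, s => by simp only [Formula.rename, Formula.sat, φ.sat_rename σ, ψ.sat_rename σ]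
  | .imp φ ψ, s => by simp only [Formula.rename, Formula.sat, φ.sat_rename σ, ψ.sat_rename σ]
  | .all x φ, s => by
      simp only [Formula.rename, Formula.sat, φ.sat_rename σ, update_comp_perm]
  | .ex x φ, s => by
      simp only [Formula.rename, Formula.sat, φ.sat_rename σ, update_comp_perm]
  | .box α φ, s => by
      simp only [Formula.rename, Formula.sat, φ.sat_rename σ, α.den_rename σ]
      exact ⟨fun H t h => by
        simpa [Function.comp_assoc] using H (t ∘ σ.symm) (by simpa [Function.comp_assoc] using h),
        fun H t h => H _ h⟩
  | .dia α φ, s => by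
      simp only [Formula.rename, Formula.sat, φ.sat_rename σ, α.den_rename σ]
      exact ⟨fun ⟨t, h⟩ => ⟨_, h⟩, fun ⟨t, h⟩ => ⟨t ∘ σ.symm, by
        simpa [Function.comp_assoc] using h⟩⟩

theorem Program.den_rename (σ : Equiv.Perm V) : (α : Program V) → (s t : State V) →
    ((α.rename σ).den s t ↔ α.den (s ∘ σ) (t ∘ σ))
  | .assign x θ, s, t => by
      simp only [Program.rename, Program.den, Term.eval_rename, ← update_comp_perm,
        σ.surjective.injective_comp_right.eq_iff]
  | .random x, s, t => by
      simp only [Program.rename, Program.den, ← update_comp_perm,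
        σ.surjective.injective_comp_right.eq_iff]
  | .test F, s, t => by
      simp only [Program.rename, Program.den, F.sat_rename σ,
        σ.surjective.injective_comp_right.eq_iff]
  | .evolve ode F, s, t => by
      simp only [Program.rename, Program.den_evolve_iff, ODE.isFlow_rename_iff (F.sat_rename σ)]
      constructor
      · rintro ⟨r, f, hf, rfl⟩
        exact ⟨r, _, hf, rfl⟩
      · rintro ⟨r, f, hf, ht⟩
        refine ⟨r, fun τ => f τ ∘ σ.symm, by simpa [Function.comp_assoc] using hf, ?_⟩
        simp only [ht, Function.comp_assoc, σ.self_comp_symm, Function.comp_id]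
  | .choice α β, s, t => by
      simp only [Program.rename, Program.den, α.den_rename σ, β.den_rename σ]
  | .seq α β, s, t => by
      simp only [Program.rename, Program.den, α.den_rename σ, β.den_rename σ]
      exact ⟨fun ⟨t, h⟩ => ⟨_, h⟩, fun ⟨t, h⟩ => ⟨t ∘ σ.symm, by
        simpa [Function.comp_assoc] using h⟩⟩
  | .star α, s, t => by
      simp only [Program.rename, Program.den, α.den_rename σ]
      constructor
      · exact fun h => h.lift (fun a => a ∘ σ) fun _ _ h => h
      · intro h
        have := h.lift (p := fun a b => α.den (a ∘ σ) (b ∘ σ)) (fun a => a ∘ σ.symm)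
          fun a b h => by simpa [Function.onFun, Function.comp_assoc] using h
        simpa [Function.onFun, Function.comp_assoc] using this

end

/-- The state in which the value of `x` is replaced by that of `θ`. -/
def State.subst (x : V) (θ : Term V) (s : State V) : State V :=
  Function.update s x (θ.eval s)

theorem State.subst_self (x : V) (θ : Term V) (s : State V) : s.subst x θ x = θ.eval s :=
  Function.update_self _ _ _

theorem State.subst_of_ne {x y : V} (h : y ≠ x) (θ : Term V) (s : State V) :
    s.subst x θ y = s y :=
  Function.update_of_ne h _ _

theorem State.subst_update {x y : V} {θ : Term V} (hyx : y ≠ x) (hy : y ∉ θ.vars) (s : State V)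
    (d : ℝ) : State.subst x θ (Function.update s y d) = Function.update (s.subst x θ) y d := by
  rw [State.subst, Term.eval_update_of_notMem hy, Function.update_comm hyx, State.subst]

theorem Term.eval_subst (x : V) (θ : Term V) (s : State V) :
    (e : Term V) → (Term.subst x θ e).eval s = e.eval (s.subst x θ)
  | .var y => by
      by_cases h : y = x
      · subst h
        simp [Term.subst, Term.eval, State.subst_self]
      · simp [Term.subst, Term.eval, h, State.subst_of_ne h]
  | .const _ => rfl
  | .neg e => congrArg (- ·) (Term.eval_subst x θ s e)
  | .add e₁ e₂ => congrArg₂ (· + ·) (Term.eval_subst x θ s e₁) (Term.eval_subst x θ s e₂)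
  | .sub e₁ e₂ => congrArg₂ (· - ·) (Term.eval_subst x θ s e₁) (Term.eval_subst x θ s e₂)
  | .mul e₁ e₂ => congrArg₂ (· * ·) (Term.eval_subst x θ s e₁) (Term.eval_subst x θ s e₂)
  | .pow e n => congrArg (· ^ n) (Term.eval_subst x θ s e)

/-- A flow of the substituted system becomes a flow of the original one, and conversely, by
applying the substitution to all its states, as `θ` is constant along the flow. -/
theorem ODE.isFlow_subst_iff {x : V} {θ : Term V} {ode : ODE V} {F : Formula V}
    (hx : x ∉ ode.vars) (hθ : Disjoint θ.vars ode.vars)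
    (hF : ∀ s, (F.subst x θ).sat s ↔ F.sat (s.subst x θ)) {s : State V} {r : ℝ}
    {f : ℝ → State V} :
    (ode.subst x θ).IsFlow (F.subst x θ) s r f ↔
      ode.IsFlow F (s.subst x θ) r (fun τ => (f τ).subst x θ) ∧ f 0 = s ∧
        ∀ ζ ∈ Set.Icc 0 r, f ζ x = s x := by
  have hne : ∀ p ∈ ode.eqs, p.1 ≠ x := fun p hp h => hx ⟨p, hp, h⟩
  constructor
  · intro h
    refine ⟨⟨h.nonneg, by rw [h.zero], fun ζ hζ p hp => ?_, fun ζ hζ y hy => ?_,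
      fun ζ hζ => (hF _).1 (h.domain ζ hζ)⟩, h.zero, fun ζ hζ => h.const ζ hζ x ?_⟩
    · have := h.deriv ζ hζ (p.1, Term.subst x θ p.2) (List.mem_map_of_mem hp)
      simpa only [State.subst_of_ne (hne p hp), ← Term.eval_subst] using this
    · by_cases hyx : y = x
      · subst hyx
        simp only [State.subst_self]
        refine θ.eval_congr fun z hz => h.const ζ hζ z ?_
        rw [ODE.vars_subst]
        exact hθ.notMem_of_mem_left hz
      · simp only [State.subst_of_ne hyx]
        exact h.const ζ hζ y (by rwa [ODE.vars_subst])
    · rwa [ODE.vars_subst]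
  · rintro ⟨h, h0, hfx⟩
    refine ⟨h.nonneg, h0, fun ζ hζ q hq => ?_, fun ζ hζ y hy => ?_,
      fun ζ hζ => (hF _).2 (h.domain ζ hζ)⟩
    · obtain ⟨p, hp, rfl⟩ := List.mem_map.1 hq
      simpa only [State.subst_of_ne (hne p hp), ← Term.eval_subst] using h.deriv ζ hζ p hp
    · by_cases hyx : y = x
      · subst hyx
        exact hfx ζ hζ
      · rw [ODE.vars_subst] at hy
        simpa only [State.subst_of_ne hyx] using h.const ζ hζ y hy

mutual

/-- The substitution lemma for formulas. -/
theorem Formula.sat_subst (x : V) (θ : Term V) : (φ : Formula V) → φ.Admissible x θ →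
    (s : State V) → ((φ.subst x θ).sat s ↔ φ.sat (s.subst x θ))
  | .cmp c e₁ e₂, _, s => by simp only [Formula.subst, Formula.sat, Term.eval_subst]
  | .not φ, h, s => by
      simp only [Formula.subst, Formula.sat, Formula.Admissible] at *
      rw [φ.sat_subst x θ h]
  | .and φ ψ, h, s => by
      simp only [Formula.subst, Formula.sat, Formula.Admissible] at *
      rw [φ.sat_subst x θ h.1, ψ.sat_subst x θ h.2]
  | .or φ ψ, h, s => by
      simp only [Formula.subst, Formula.sat, Formula.Admissible] at *
      rw [φ.sat_subst x θ h.1, ψ.sat_subst x θ h.2]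
  | .imp φ ψ, h, s => by
      simp only [Formula.subst, Formula.sat, Formula.Admissible] at *
      rw [φ.sat_subst x θ h.1, ψ.sat_subst x θ h.2]
  | .all y φ, h, s => by
      by_cases hx : x ∈ (Formula.all y φ).fv
      · simp only [Formula.Admissible, hx, not_true_eq_false, false_or] at h
        rw [Formula.subst, if_pos hx]
        simp only [Formula.fv] at hx
        simp only [Formula.sat]
        refine forall_congr' fun d => ?_
        rw [φ.sat_subst x θ h.2, State.subst_update (fun e => hx.2 e.symm) h.1]
      · rw [Formula.subst, if_neg hx]
        exact (Formula.sat_update_of_notMem hx _ _).symm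
  | .ex y φ, h, s => by
      by_cases hx : x ∈ (Formula.ex y φ).fv
      · simp only [Formula.Admissible, hx, not_true_eq_false, false_or] at h
        rw [Formula.subst, if_pos hx]
        simp only [Formula.fv] at hx
        simp only [Formula.sat]
        refine exists_congr fun d => ?_
        rw [φ.sat_subst x θ h.2, State.subst_update (fun e => hx.2 e.symm) h.1]
      · rw [Formula.subst, if_neg hx]
        exact (Formula.sat_update_of_notMem hx _ _).symm
  | .box α φ, h, s => by
      by_cases hx : x ∈ (Formula.box α φ).fv
      · simp only [Formula.Admissible, hx, not_true_eq_false, false_or] at h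
        obtain ⟨hb, hd, hα, hφ⟩ := h
        rw [Formula.subst, if_pos hx]
        simp only [Formula.sat, φ.sat_subst x θ hφ]
        have hden := α.den_subst x θ hb hd hα
        constructor
        · intro H w hw
          obtain ⟨t, ht, rfl⟩ := (hden s).2 w hw
          exact H t ht
        · exact fun H t ht => H _ ((hden s).1 t ht)
      · rw [Formula.subst, if_neg hx]
        exact (Formula.sat_update_of_notMem hx _ _).symm
  | .dia α φ, h, s => by
      by_cases hx : x ∈ (Formula.dia α φ).fv
      · simp only [Formula.Admissible, hx, not_true_eq_false, false_or] at h
        obtain ⟨hb, hd, hα, hφ⟩ := h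
        rw [Formula.subst, if_pos hx]
        simp only [Formula.sat, φ.sat_subst x θ hφ]
        have hden := α.den_subst x θ hb hd hα
        constructor
        · exact fun ⟨t, ht, H⟩ => ⟨_, (hden s).1 t ht, H⟩
        · rintro ⟨w, hw, H⟩
          obtain ⟨t, ht, rfl⟩ := (hden s).2 w hw
          exact ⟨t, ht, H⟩
      · rw [Formula.subst, if_neg hx]
        exact (Formula.sat_update_of_notMem hx _ _).symm

/-- The substitution lemma for programs: `State.subst x θ` is a functional bisimulation from the
transition relation of the substituted program to that of the original one. -/
theorem Program.den_subst (x : V) (θ : Term V) : (α : Program V) → x ∉ α.bv →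
    Disjoint θ.vars α.bv → α.Admissible x θ → (s : State V) →
    (∀ t, (α.subst x θ).den s t → α.den (s.subst x θ) (t.subst x θ)) ∧
      ∀ w, α.den (s.subst x θ) w → ∃ t, (α.subst x θ).den s t ∧ t.subst x θ = w
  | .assign y η, hx, hθ, _, s => by
      simp only [Program.bv, Set.mem_singleton_iff, Set.disjoint_singleton_right,
        Program.subst, Program.den, Term.eval_subst] at *
      constructor
      · rintro t rfl
        exact State.subst_update (Ne.symm hx) hθ _ _
      · rintro w rfl
        exact ⟨_, rfl, State.subst_update (Ne.symm hx) hθ _ _⟩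
  | .random y, hx, hθ, _, s => by
      simp only [Program.bv, Set.mem_singleton_iff, Set.disjoint_singleton_right,
        Program.subst, Program.den] at *
      constructor
      · rintro t ⟨d, rfl⟩
        exact ⟨d, State.subst_update (Ne.symm hx) hθ _ _⟩
      · rintro w ⟨d, rfl⟩
        exact ⟨_, ⟨d, rfl⟩, State.subst_update (Ne.symm hx) hθ _ _⟩
  | .test F, _, _, hF, s => by
      simp only [Program.Admissible, Program.subst, Program.den] at *
      constructor
      · rintro t ⟨rfl, h⟩
        exact ⟨rfl, (F.sat_subst x θ hF _).1 h⟩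
      · rintro w ⟨rfl, h⟩
        exact ⟨s, ⟨rfl, (F.sat_subst x θ hF _).2 h⟩, rfl⟩
  | .evolve ode F, hx, hθ, hF, s => by
      simp only [Program.Admissible, Program.bv, Program.subst, Program.den_evolve_iff] at *
      have hiff := fun r f => ODE.isFlow_subst_iff (s := s) (r := r) (f := f) hx hθ
        (F.sat_subst x θ hF)
      constructor
      · rintro t ⟨r, f, hf, rfl⟩
        exact ⟨r, _, ((hiff r f).1 hf).1, rfl⟩
      · rintro w ⟨r, f, hf, rfl⟩
        -- undo the substitution along the flow; outside `[0, r]` nothing is known of `f`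
        have hinv : ∀ ζ ∈ Set.Icc 0 r,
            State.subst x θ (Function.update (f ζ) x (s x)) = f ζ := by
          intro ζ hζ
          have hval : θ.eval (Function.update (f ζ) x (s x)) = f ζ x := by
            rw [hf.const ζ hζ x hx, State.subst_self]
            refine θ.eval_congr fun y hy => ?_
            by_cases hyx : y = x
            · subst hyx
              exact Function.update_self _ _ _
            · rw [Function.update_of_ne hyx, hf.const ζ hζ y (hθ.notMem_of_mem_left hy),
                State.subst_of_ne hyx]
          rw [State.subst, hval, Function.update_idem, Function.update_eq_self]
        have hr : r ∈ Set.Icc 0 r := ⟨hf.nonneg, le_rfl⟩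
        have h0 : (0 : ℝ) ∈ Set.Icc 0 r := ⟨le_rfl, hf.nonneg⟩
        refine ⟨_, ⟨r, fun τ => Function.update (f τ) x (s x), (hiff r _).2 ⟨?_, ?_, ?_⟩, rfl⟩,
          hinv r hr⟩
        · refine ⟨hf.nonneg, (hinv 0 h0).trans hf.zero, fun ζ hζ p hp => ?_, fun ζ hζ y hy => ?_,
            fun ζ hζ => ?_⟩
          · rw [hinv ζ hζ]
            have hp1 : p.1 ≠ x := fun h => hx ⟨p, hp, h⟩
            simpa only [State.subst_of_ne hp1, Function.update_of_ne hp1] using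
              hf.deriv ζ hζ p hp
          · rw [hinv ζ hζ]
            exact hf.const ζ hζ y hy
          · rw [hinv ζ hζ]
            exact hf.domain ζ hζ
        · simp only [hf.zero, State.subst, Function.update_idem, Function.update_eq_self]
        · exact fun ζ _ => Function.update_self _ _ _
  | .choice α β, hx, hθ, hF, s => by
      simp only [Program.Admissible, Program.bv, Program.subst, Program.den, Set.mem_union,
        not_or, Set.disjoint_union_right] at *
      have h₁ := α.den_subst x θ hx.1 hθ.1 hF.1 s
      have h₂ := β.den_subst x θ hx.2 hθ.2 hF.2 s
      constructor
      · exact fun t h => h.imp (h₁.1 t) (h₂.1 t)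
      · rintro w (h | h)
        · obtain ⟨t, ht, e⟩ := h₁.2 w h
          exact ⟨t, .inl ht, e⟩
        · obtain ⟨t, ht, e⟩ := h₂.2 w h
          exact ⟨t, .inr ht, e⟩
  | .seq α β, hx, hθ, hF, s => by
      simp only [Program.Admissible, Program.bv, Program.subst, Program.den, Set.mem_union,
        not_or, Set.disjoint_union_right] at *
      have h₁ := α.den_subst x θ hx.1 hθ.1 hF.1
      have h₂ := β.den_subst x θ hx.2 hθ.2 hF.2
      constructor
      · exact fun t ⟨u, hu, ht⟩ => ⟨_, (h₁ s).1 u hu, (h₂ u).1 t ht⟩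
      · rintro w ⟨v, hv, hw⟩
        obtain ⟨u, hu, rfl⟩ := (h₁ s).2 v hv
        obtain ⟨t, ht, e⟩ := (h₂ u).2 w hw
        exact ⟨t, ⟨u, hu, ht⟩, e⟩
  | .star α, hx, hθ, hF, s => by
      simp only [Program.Admissible, Program.bv, Program.subst, Program.den] at *
      have h₁ := α.den_subst x θ hx hθ hF
      constructor
      · exact fun t h => h.lift _ fun a b hab => (h₁ a).1 b hab
      · intro w h
        induction h with
        | refl => exact ⟨s, .refl, rfl⟩
        | tail _ hstep ih =>
          obtain ⟨u, hu, rfl⟩ := ih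
          obtain ⟨t, ht, e⟩ := (h₁ u).2 _ hstep
          exact ⟨t, hu.tail ht, e⟩

end

end Substitution

/-! ### Continuous evolutions -/

section Flows

variable {V : Type*} [DecidableEq V]

theorem ODE.IsFlow.left_mem {ode : ODE V} {F : Formula V} {s : State V} {r : ℝ}
    {f : ℝ → State V} (h : ode.IsFlow F s r f) : (0 : ℝ) ∈ Set.Icc 0 r := ⟨le_rfl, h.nonneg⟩

theorem ODE.IsFlow.right_mem {ode : ODE V} {F : Formula V} {s : State V} {r : ℝ}
    {f : ℝ → State V} (h : ode.IsFlow F s r f) : r ∈ Set.Icc 0 r := ⟨h.nonneg, le_rfl⟩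

/-- Flows can be stopped early. -/
theorem ODE.IsFlow.restrict {ode : ODE V} {F : Formula V} {s : State V} {r ζ : ℝ}
    {f : ℝ → State V} (h : ode.IsFlow F s r f) (hζ : ζ ∈ Set.Icc 0 r) : ode.IsFlow F s ζ f := by
  have hsub : Set.Icc 0 ζ ⊆ Set.Icc 0 r := Set.Icc_subset_Icc_right hζ.2
  exact ⟨hζ.1, h.zero, fun τ hτ p hp => (h.deriv τ (hsub hτ) p hp).mono hsub,
    fun τ hτ => h.const τ (hsub hτ), fun τ hτ => h.domain τ (hsub hτ)⟩

/-- The flow of duration zero. -/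
theorem ODE.isFlow_zero (ode : ODE V) {F : Formula V} {s : State V} (hF : F.sat s) :
    ode.IsFlow F s 0 (fun _ => s) := by
  refine ⟨le_rfl, rfl, fun ζ hζ p _ => ?_, fun _ _ _ _ => rfl, fun _ _ => hF⟩
  rw [Set.Icc_self] at hζ ⊢
  rw [Set.mem_singleton_iff.1 hζ]
  exact HasFDerivWithinAt.singleton

/-- The same curve is a flow of another system for the same variables if the right-hand sides agree
along it and it stays in the new domain. -/
theorem ODE.IsFlow.imp {ode ode' : ODE V} {F F' : Formula V} {s : State V} {r : ℝ}
    {f : ℝ → State V} (h : ode.IsFlow F s r f) (hv : ode.vars = ode'.vars)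
    (hode : ∀ ζ ∈ Set.Icc 0 r, ∀ q ∈ ode'.eqs, ∃ p ∈ ode.eqs, p.1 = q.1 ∧
      p.2.eval (f ζ) = q.2.eval (f ζ))
    (hF : ∀ ζ ∈ Set.Icc 0 r, F'.sat (f ζ)) : ode'.IsFlow F' s r f := by
  refine ⟨h.nonneg, h.zero, fun ζ hζ q hq => ?_, fun ζ hζ x hx => h.const ζ hζ x (hv ▸ hx), hF⟩
  obtain ⟨p, hp, h1, h2⟩ := hode ζ hζ q hq
  rw [← h1, ← h2]
  exact h.deriv ζ hζ p hp

theorem ODE.IsFlow.imp_domain {ode : ODE V} {F F' : Formula V} {s : State V} {r : ℝ}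
    {f : ℝ → State V} (h : ode.IsFlow F s r f) (hF : ∀ ζ ∈ Set.Icc 0 r, F'.sat (f ζ)) :
    ode.IsFlow F' s r f :=
  h.imp rfl (fun _ _ q hq => ⟨q, hq, rfl, rfl⟩) hF

/-- Along a flow, every variable has its right-hand side as derivative, which is zero if the
variable has no equation. -/
theorem ODE.IsFlow.hasDerivWithinAt_var {ode : ODE V} {F : Formula V} {s : State V} {r ζ : ℝ}
    {f : ℝ → State V} (h : ode.IsFlow F s r f) (hζ : ζ ∈ Set.Icc 0 r) (x : V) :
    HasDerivWithinAt (fun τ => f τ x) ((ode.rhs x).eval (f ζ)) (Set.Icc 0 r) ζ := by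
  rw [ODE.rhs]
  cases hl : ode.eqs.lookup x with
  | none =>
    have hx : x ∉ ode.vars := by
      rintro ⟨p, hp, rfl⟩
      simpa using List.lookup_eq_none_iff.1 hl p hp
    exact (hasDerivWithinAt_const ζ _ (s x)).congr (fun τ hτ => h.const τ hτ x hx)
      (h.const ζ hζ x hx)
  | some θ =>
    obtain ⟨l₁, l₂, he, -⟩ := List.lookup_eq_some_iff.1 hl
    exact h.deriv ζ hζ (x, θ) (by simp [he])

/-- The Lie derivative of a term is its time derivative along flows. -/
theorem ODE.IsFlow.hasDerivWithinAt_eval {ode : ODE V} {F : Formula V} {s : State V} {r ζ : ℝ}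
    {f : ℝ → State V} (h : ode.IsFlow F s r f) (hζ : ζ ∈ Set.Icc 0 r) : (e : Term V) →
    HasDerivWithinAt (fun τ => e.eval (f τ)) ((e.lie ode).eval (f ζ)) (Set.Icc 0 r) ζ
  | .var x => h.hasDerivWithinAt_var hζ x
  | .const c => hasDerivWithinAt_const ζ _ c
  | .neg e => (h.hasDerivWithinAt_eval hζ e).fun_neg
  | .add e₁ e₂ => (h.hasDerivWithinAt_eval hζ e₁).fun_add (h.hasDerivWithinAt_eval hζ e₂)
  | .sub e₁ e₂ => (h.hasDerivWithinAt_eval hζ e₁).fun_sub (h.hasDerivWithinAt_eval hζ e₂)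
  | .mul e₁ e₂ => (h.hasDerivWithinAt_eval hζ e₁).fun_mul (h.hasDerivWithinAt_eval hζ e₂)
  | .pow e n => (h.hasDerivWithinAt_eval hζ e).fun_pow n

theorem sub_le_sub_of_hasDerivWithinAt_le {u v u' v' : ℝ → ℝ} {r : ℝ} (hr : 0 ≤ r)
    (hu : ∀ ζ ∈ Set.Icc 0 r, HasDerivWithinAt u (u' ζ) (Set.Icc 0 r) ζ)
    (hv : ∀ ζ ∈ Set.Icc 0 r, HasDerivWithinAt v (v' ζ) (Set.Icc 0 r) ζ)
    (h : ∀ ζ ∈ Set.Icc 0 r, u' ζ ≤ v' ζ) : v 0 - u 0 ≤ v r - u r := by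
  have hd : ∀ ζ ∈ Set.Icc 0 r, HasDerivWithinAt (fun τ => v τ - u τ) (v' ζ - u' ζ)
      (Set.Icc 0 r) ζ := fun ζ hζ => (hv ζ hζ).fun_sub (hu ζ hζ)
  refine monotoneOn_of_hasDerivWithinAt_nonneg (convex_Icc 0 r)
    (fun ζ hζ => (hd ζ hζ).continuousWithinAt)
    (fun ζ hζ => (hd ζ (interior_subset hζ)).mono interior_subset)
    (fun ζ hζ => sub_nonneg.2 (h ζ (interior_subset hζ))) ⟨le_rfl, hr⟩ ⟨hr, le_rfl⟩ hr

theorem ODE.IsFlow.sub_le_sub_of_lie_le {ode : ODE V} {F : Formula V} {s : State V} {r : ℝ}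
    {f : ℝ → State V} (h : ode.IsFlow F s r f) {e₁ e₂ : Term V}
    (hle : ∀ ζ ∈ Set.Icc 0 r, (e₁.lie ode).eval (f ζ) ≤ (e₂.lie ode).eval (f ζ)) :
    e₂.eval s - e₁.eval s ≤ e₂.eval (f r) - e₁.eval (f r) := by
  have := sub_le_sub_of_hasDerivWithinAt_le h.nonneg (fun ζ hζ => h.hasDerivWithinAt_eval hζ e₁)
    (fun ζ hζ => h.hasDerivWithinAt_eval hζ e₂) hle
  simpa only [h.zero] using this

/-- The differential invariant principle: a formula whose differential holds along a flow is
preserved by it. -/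
theorem ODE.IsFlow.sat_of_lie {ode : ODE V} {F : Formula V} {s : State V} {r : ℝ}
    {f : ℝ → State V} (h : ode.IsFlow F s r f) : (φ : Formula V) →
    (∀ ζ ∈ Set.Icc 0 r, (φ.lie ode).sat (f ζ)) → φ.sat s → φ.sat (f r)
  | .cmp c e₁ e₂, hl, hs => by
      have h₁ := h.sub_le_sub_of_lie_le (e₁ := e₁) (e₂ := e₂)
      have h₂ := h.sub_le_sub_of_lie_le (e₁ := e₂) (e₂ := e₁)
      cases c <;> simp only [Formula.lie, Formula.sat, Cmp.rel] at hl hs ⊢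
      · linarith [h₁ fun ζ hζ => (hl ζ hζ).le, h₂ fun ζ hζ => (hl ζ hζ).ge]
      · intro he
        apply hs
        linarith [h₁ fun ζ hζ => (hl ζ hζ).le, h₂ fun ζ hζ => (hl ζ hζ).ge]
      · linarith [h₂ hl]
      · linarith [h₂ hl]
      · linarith [h₁ hl]
      · linarith [h₁ hl]
  | .and φ ψ, hl, hs => by
      simp only [Formula.lie, Formula.sat] at hl hs ⊢
      exact ⟨h.sat_of_lie φ (fun ζ hζ => (hl ζ hζ).1) hs.1,
        h.sat_of_lie ψ (fun ζ hζ => (hl ζ hζ).2) hs.2⟩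
  | .or φ ψ, hl, hs => by
      simp only [Formula.lie, Formula.sat] at hl hs ⊢
      exact hs.imp (h.sat_of_lie φ fun ζ hζ => (hl ζ hζ).1)
        (h.sat_of_lie ψ fun ζ hζ => (hl ζ hζ).2)
  | .not _, hl, _ | .imp _ _, hl, _ | .all _ _, hl, _ | .ex _ _, hl, _ | .box _ _, hl, _
  | .dia _ _, hl, _ => by
      have := hl 0 h.left_mem
      simp [Formula.lie, Formula.falsum, Formula.sat, Cmp.rel, Term.eval] at this

theorem ODE.IsFlow.continuousOn_eval {ode : ODE V} {F : Formula V} {s : State V} {r : ℝ}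
    {f : ℝ → State V} (h : ode.IsFlow F s r f) (e : Term V) :
    ContinuousOn (fun τ => e.eval (f τ)) (Set.Icc 0 r) :=
  fun _ hζ => (h.hasDerivWithinAt_eval hζ e).continuousWithinAt

/-- Linear differential equations have global solutions, by variation of constants. -/
theorem exists_hasDerivAt_linear {a b : ℝ → ℝ} (ha : Continuous a) (hb : Continuous b) (d : ℝ) :
    ∃ y : ℝ → ℝ, y 0 = d ∧ ∀ τ, HasDerivAt y (a τ * y τ + b τ) τ := by
  let A : ℝ → ℝ := fun τ => ∫ σ in (0 : ℝ)..τ, a σ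
  have hA : ∀ τ, HasDerivAt A (a τ) τ := fun τ => ha.integral_hasStrictDerivAt 0 τ |>.hasDerivAt
  have hAc : Continuous A := continuous_iff_continuousAt.2 fun τ => (hA τ).continuousAt
  let B : ℝ → ℝ := fun τ => ∫ σ in (0 : ℝ)..τ, b σ * Real.exp (-A σ)
  have hB : ∀ τ, HasDerivAt B (b τ * Real.exp (-A τ)) τ := fun τ =>
    (Continuous.integral_hasStrictDerivAt (by fun_prop) 0 τ).hasDerivAt
  refine ⟨fun τ => Real.exp (A τ) * (d + B τ), by simp [A, B], fun τ => ?_⟩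
  have : Real.exp (A τ) * Real.exp (-A τ) = 1 := by rw [← Real.exp_add]; simp
  refine ((hA τ).exp.fun_mul ((hB τ).const_add d)).congr_deriv ?_
  linear_combination b τ * this

/-- A flow extends to a system with an additional linear equation for a ghost variable `y`: linear
equations have solutions for all times, so the ghost does not cut the duration short. -/
theorem ODE.IsFlow.exists_ghost {ode ode' : ODE V} {F : Formula V} {s : State V} {r : ℝ}
    {f : ℝ → State V} (h : ode.IsFlow F s r f) {y : V} {a b : Term V}
    (he : ode'.eqs = (y, .add (.mul a (.var y)) b) :: ode.eqs)
    (hode : y ∉ ode.rhsVars) (hF : y ∉ F.fv) (ha : y ∉ a.vars) (hb : y ∉ b.vars) (d : ℝ) :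
    ∃ Y : ℝ → ℝ, ode'.IsFlow F (Function.update s y d) r
      (fun τ => Function.update (f τ) y (Y τ)) := by
  -- coefficients of the ghost equation, extended continuously from `[0, r]` to the real line
  have hext : ∀ e : Term V, Continuous fun τ => e.eval (f (Set.projIcc 0 r h.nonneg τ)) :=
    fun e => (continuousOn_iff_continuous_domRestrict.1 (h.continuousOn_eval e)).comp
      continuous_projIcc
  obtain ⟨Y, hY0, hY⟩ := exists_hasDerivAt_linear (hext a) (hext b) d
  have hnodup := ode'.nodup
  rw [he, List.map_cons, List.nodup_cons] at hnodup
  have hy : ∀ p ∈ ode.eqs, p.1 ≠ y := fun p hp h' =>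
    hnodup.1 (List.mem_map.2 ⟨p, hp, h'⟩)
  refine ⟨Y, h.nonneg, by rw [h.zero, hY0], fun ζ hζ q hq => ?_, fun ζ hζ x hx => ?_,
    fun ζ hζ => (Formula.sat_update_of_notMem hF _ _).2 (h.domain ζ hζ)⟩
  · rw [he] at hq
    rcases List.mem_cons.1 hq with rfl | hq
    · have := (hY ζ).hasDerivWithinAt (s := Set.Icc 0 r)
      rw [Set.projIcc_of_mem h.nonneg hζ] at this
      simpa only [Term.eval, Term.eval_update_of_notMem ha, Term.eval_update_of_notMem hb,
        Function.update_self] using this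
    · simp only [Function.update_of_ne (hy q hq)]
      rw [Term.eval_update_of_notMem fun h' => hode ⟨q, hq, h'⟩]
      exact h.deriv ζ hζ q hq
  · have hxy : x ≠ y := by
      rintro rfl
      exact hx ⟨_, by rw [he]; exact List.mem_cons_self, rfl⟩
    rw [Function.update_of_ne hxy, Function.update_of_ne hxy]
    refine h.const ζ hζ x fun ⟨p, hp, hpx⟩ => hx ⟨p, ?_, hpx⟩
    rw [he]
    exact List.mem_cons_of_mem _ hp

/-- Forgetting a ghost variable `y` turns flows of the extended system into flows of the original
one. -/
theorem ODE.IsFlow.of_ghost {ode ode' : ODE V} {F : Formula V} {s : State V} {r d : ℝ}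
    {f : ℝ → State V} {y : V} {η : Term V} (he : ode'.eqs = (y, η) :: ode.eqs)
    (h : ode'.IsFlow F (Function.update s y d) r f) (hode : y ∉ ode.rhsVars) (hF : y ∉ F.fv) :
    ode.IsFlow F s r (fun τ => Function.update (f τ) y (s y)) := by
  have hnodup := ode'.nodup
  rw [he, List.map_cons, List.nodup_cons] at hnodup
  have hy : ∀ p ∈ ode.eqs, p.1 ≠ y := fun p hp h' =>
    hnodup.1 (List.mem_map.2 ⟨p, hp, h'⟩)
  refine ⟨h.nonneg, by simp [h.zero], fun ζ hζ q hq => ?_, fun ζ hζ x hx => ?_,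
    fun ζ hζ => (Formula.sat_update_of_notMem hF _ _).2 (h.domain ζ hζ)⟩
  · simp only [Function.update_of_ne (hy q hq)]
    rw [Term.eval_update_of_notMem fun h' => hode ⟨q, hq, h'⟩]
    exact h.deriv ζ hζ q (by rw [he]; exact List.mem_cons_of_mem _ hq)
  · by_cases hxy : x = y
    · subst hxy
      exact Function.update_self _ _ _
    · rw [Function.update_of_ne hxy, h.const ζ hζ x, Function.update_of_ne hxy]
      rintro ⟨p, hp, hpx⟩
      rw [he] at hp
      rcases List.mem_cons.1 hp with rfl | hp
      · exact hxy hpx.symm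
      · exact hx ⟨p, hp, hpx⟩

/-- The flow of a single equation with constant right-hand side is linear. -/
theorem ODE.IsFlow.eq_of_const_rhs {ode : ODE V} {F : Formula V} {s : State V} {r ζ : ℝ}
    {f : ℝ → State V} {x : V} {c : Term V} (h : ode.IsFlow F s r f) (he : ode.eqs = [(x, c)])
    (hc : x ∉ c.vars) (hζ : ζ ∈ Set.Icc 0 r) :
    f ζ = Function.update s x (s x + c.eval s * ζ) := by
  have hconst : ∀ τ ∈ Set.Icc 0 r, ∀ y ≠ x, f τ y = s y := fun τ hτ y hy =>
    h.const τ hτ y fun ⟨p, hp, hpy⟩ => by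
      rw [he, List.mem_singleton] at hp
      subst hp
      exact hy hpy.symm
  have hsub : Set.Icc 0 ζ ⊆ Set.Icc 0 r := Set.Icc_subset_Icc_right hζ.2
  have hu : ∀ τ ∈ Set.Icc 0 ζ, HasDerivWithinAt (fun τ => f τ x) (c.eval s) (Set.Icc 0 ζ) τ := by
    intro τ hτ
    have := (h.deriv τ (hsub hτ) (x, c) (by simp [he])).mono hsub
    rwa [c.eval_congr (s' := s) fun y hy => hconst τ (hsub hτ) y
      (ne_of_mem_of_not_mem hy hc)] at this
  have hv : ∀ τ ∈ Set.Icc 0 ζ, HasDerivWithinAt (fun τ => c.eval s * τ) (c.eval s)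
      (Set.Icc 0 ζ) τ := fun τ _ => by
    simpa using (hasDerivWithinAt_id τ _).const_mul (c.eval s)
  have h₁ := sub_le_sub_of_hasDerivWithinAt_le hζ.1 hu hv fun _ _ => le_rfl
  have h₂ := sub_le_sub_of_hasDerivWithinAt_le hζ.1 hv hu fun _ _ => le_rfl
  simp only [h.zero] at h₁ h₂
  funext y
  by_cases hyx : y = x
  · subst hyx
    rw [Function.update_self]
    linarith
  · rw [Function.update_of_ne hyx]
    exact hconst ζ hζ y hyx

theorem ODE.isFlow_of_const_rhs {ode : ODE V} {F : Formula V} {s : State V} {r : ℝ} {x : V}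
    {c : Term V} (he : ode.eqs = [(x, c)]) (hc : x ∉ c.vars) (hr : 0 ≤ r)
    (hF : ∀ ζ ∈ Set.Icc 0 r, F.sat (Function.update s x (s x + c.eval s * ζ))) :
    ode.IsFlow F s r (fun τ => Function.update s x (s x + c.eval s * τ)) := by
  refine ⟨hr, by simp, fun ζ _ p hp => ?_, fun ζ _ y hy => ?_, hF⟩
  · rw [he, List.mem_singleton] at hp
    subst hp
    simp only [Function.update_self, Term.eval_update_of_notMem hc]
    simpa using ((hasDerivWithinAt_id ζ _).const_mul (c.eval s)).const_add (s x)
  · refine Function.update_of_ne ?_ _ _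
    rintro rfl
    exact hy ⟨_, by rw [he]; exact List.mem_cons_self, rfl⟩

end Flows

/-! ### Soundness of the proof calculus -/

section Soundness

variable {V : Type*} [DecidableEq V]

theorem Formula.sat_iff {φ ψ : Formula V} {s : State V} :
    (φ.iff ψ).sat s ↔ (φ.sat s ↔ ψ.sat s) := by
  simp only [Formula.iff, Formula.sat, iff_def]

theorem Formula.propEval_sat (s : State V) :
    (φ : Formula V) → (φ.propEval (fun ψ => ψ.sat s) ↔ φ.sat s)
  | .not φ => by simp only [Formula.propEval, Formula.sat, φ.propEval_sat s]
  | .and φ ψ => by simp only [Formula.propEval, Formula.sat, φ.propEval_sat s, ψ.propEval_sat s]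
  | .or φ ψ => by simp only [Formula.propEval, Formula.sat, φ.propEval_sat s, ψ.propEval_sat s]
  | .imp φ ψ => by simp only [Formula.propEval, Formula.sat, φ.propEval_sat s, ψ.propEval_sat s]
  | .cmp _ _ _ | .all _ _ | .ex _ _ | .box _ _ | .dia _ _ => by simp only [Formula.propEval]

theorem Formula.sat_box_assign {x : V} {θ : Term V} {φ : Formula V} {s : State V} :
    (Formula.box (.assign x θ) φ).sat s ↔ φ.sat (Function.update s x (θ.eval s)) := by
  simp only [Formula.sat, Program.den, forall_eq]

theorem Formula.sat_box_evolve {ode : ODE V} {F φ : Formula V} {s : State V} :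
    (Formula.box (.evolve ode F) φ).sat s ↔ ∀ r f, ode.IsFlow F s r f → φ.sat (f r) := by
  simp only [Formula.sat, Program.den_evolve_iff]
  exact ⟨fun H r f hf => H _ ⟨r, f, hf, rfl⟩, fun H t ⟨r, f, hf, ht⟩ => ht ▸ H r f hf⟩

theorem valid_boundRename (x y : V) (θ : Term V) {φ : Formula V} (hy : y ∉ φ.fv) :
    (Formula.iff (.box (.assign x θ) φ)
      (.box (.assign y θ) (φ.rename (Equiv.swap x y)))).Valid := by
  intro s
  rw [Formula.sat_iff, Formula.sat_box_assign, Formula.sat_box_assign, Formula.sat_rename]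
  refine φ.sat_congr fun z hz => ?_
  have hzy : z ≠ y := ne_of_mem_of_not_mem hz hy
  by_cases hzx : z = x
  · subst hzx
    simp
  · simp [hzx, hzy, Equiv.swap_apply_of_ne_of_ne hzx hzy]

/-- The loop variant `v` decreases by one in each iteration, so it is nonpositive after finitely
many of them. -/
theorem valid_convergence {α : Program V} {v : V} (φ : Formula V) (hv : α.Fresh v) :
    (Formula.imp
      (.box (.star α) (.all v (.imp (.cmp .gt (.var v) (.const 0))
        (.imp φ (.dia α (.box (.assign v (.sub (.var v) (.const 1))) φ))))))
      (.all v (.imp φ (.dia (.star α)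
        (.ex v (.and (.cmp .le (.var v) (.const 0)) φ)))))).Valid := by
  intro s
  simp only [Formula.sat, Program.den, Cmp.rel, Term.eval, forall_eq, Function.update_self]
  intro H d hφ
  -- `u` is the state reached so far, up to the value of `v`, which is tracked separately
  have key : ∀ n : ℕ, ∀ (u : State V) (d : ℝ), d ≤ n →
      Relation.ReflTransGen (fun a b => α.den a b) s u → φ.sat (Function.update u v d) →
      ∃ w e, Relation.ReflTransGen (fun a b => α.den a b) u w ∧ e ≤ 0 ∧
        φ.sat (Function.update w v e) := by
    intro n
    induction n with
    | zero => exact fun u d hd _ hφ => ⟨u, d, .refl, by simpa using hd, hφ⟩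
    | succ n ih =>
      intro u d hd hu hφ
      by_cases hd0 : d ≤ 0
      · exact ⟨u, d, .refl, hd0, hφ⟩
      · obtain ⟨t, ht, hφt⟩ := H u hu d (not_le.1 hd0) hφ
        have htv : t v = d := by simpa using α.den_eq_of_notMem_bv ht hv.2
        have hstep : α.den u (Function.update t v (u v)) := by
          have := hv.den_update ht (u v)
          rwa [Function.update_idem, Function.update_eq_self] at this
        obtain ⟨w, e, hw, he, hφw⟩ := ih (Function.update t v (u v)) (d - 1)
          (by push_cast at hd; linarith) (hu.tail hstep)
          (by rwa [Function.update_idem, ← htv])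
        exact ⟨w, e, hw.head hstep, he, hφw⟩
  obtain ⟨n, hn⟩ := exists_nat_ge d
  obtain ⟨w, e, hw, he, hφw⟩ := key n s d hn .refl hφ
  have hw' : (Program.star α).den s w := by simpa only [Program.den] using hw
  have := hv.star.den_update hw' d
  simp only [Program.den] at this
  exact ⟨_, this, e, he, by rwa [Function.update_idem]⟩

theorem valid_diffCut (ode : ODE V) (F C φ : Formula V) :
    (Formula.imp (.box (.evolve ode F) C)
      (.iff (.box (.evolve ode F) φ) (.box (.evolve ode (.and F C)) φ))).Valid := by
  intro s
  rw [Formula.sat, Formula.sat_iff]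
  simp only [Formula.sat_box_evolve]
  intro hC
  constructor
  · intro H r f hf
    refine H r f (hf.imp_domain fun ζ hζ => ?_)
    have := hf.domain ζ hζ
    rw [Formula.sat] at this
    exact this.1
  · intro H r f hf
    refine H r f (hf.imp_domain fun ζ hζ => ?_)
    rw [Formula.sat]
    exact ⟨hf.domain ζ hζ, hC ζ f (hf.restrict hζ)⟩

theorem valid_diffInv (ode : ODE V) (F φ : Formula V) :
    (Formula.imp (.imp F (.box (.evolve ode F) (φ.lie ode)))
      (.iff (.box (.evolve ode F) φ) (.box (.test F) φ))).Valid := by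
  intro s
  rw [Formula.sat, Formula.sat, Formula.sat_iff]
  simp only [Formula.sat_box_evolve]
  simp only [Formula.sat, Program.den]
  intro hl
  constructor
  · rintro H t ⟨rfl, hF⟩
    exact H 0 _ (ode.isFlow_zero hF)
  · intro H r f hf
    have hF : F.sat s := by simpa only [hf.zero] using hf.domain 0 hf.left_mem
    exact hf.sat_of_lie φ (fun ζ hζ => hl hF ζ f (hf.restrict hζ)) (H s ⟨rfl, hF⟩)

theorem valid_diffGhost {ode ode' : ODE V} {F φ : Formula V} {y : V} {a b : Term V}
    (he : ode'.eqs = (y, .add (.mul a (.var y)) b) :: ode.eqs)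
    (hode : y ∉ ode.rhsVars) (hF : y ∉ F.fv) (hφ : y ∉ φ.fv) (ha : y ∉ a.vars) (hb : y ∉ b.vars) :
    (Formula.iff (.box (.evolve ode F) φ) (.ex y (.box (.evolve ode' F) φ))).Valid := by
  intro s
  rw [Formula.sat_iff, Formula.sat_box_evolve, Formula.sat]
  simp only [Formula.sat_box_evolve]
  constructor
  · refine fun H => ⟨0, fun r f hf => ?_⟩
    have := H r _ (hf.of_ghost he hode hF)
    exact (Formula.sat_update_of_notMem hφ _ _).1 this
  · rintro ⟨d, H⟩ r f hf
    obtain ⟨Y, hY⟩ := hf.exists_ghost he hode hF ha hb d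
    have := H r _ hY
    exact (Formula.sat_update_of_notMem hφ _ _).1 this

theorem valid_diffSolve {ode : ODE V} {F φ : Formula V} {x t r : V} {c : Term V}
    (he : ode.eqs = [(x, c)]) (htx : t ≠ x) (hrx : r ≠ x) (htr : t ≠ r) (hxc : x ∉ c.vars)
    (htc : t ∉ c.vars) (hrc : r ∉ c.vars) (htF : t ∉ F.fv) (hrF : r ∉ F.fv) (htφ : t ∉ φ.fv) :
    (Formula.iff (.box (.evolve ode F) φ)
      (.all t (.imp (.cmp .ge (.var t) (.const 0))
        (.imp
          (.all r (.imp (.and (.cmp .le (.const 0) (.var r)) (.cmp .le (.var r) (.var t)))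
            (.box (.assign x (.add (.var x) (.mul c (.var r)))) F)))
          (.box (.assign x (.add (.var x) (.mul c (.var t)))) φ))))).Valid := by
  intro s
  have hF : ∀ a b : ℝ, F.sat (Function.update (Function.update (Function.update s t a) r b) x
      (s x + c.eval s * b)) ↔ F.sat (Function.update s x (s x + c.eval s * b)) := fun a b => by
    rw [Function.update_comm hrx, Formula.sat_update_of_notMem hrF, Function.update_comm htx,
      Formula.sat_update_of_notMem htF]
  have hφ : ∀ a : ℝ, φ.sat (Function.update (Function.update s t a) x (s x + c.eval s * a)) ↔
      φ.sat (Function.update s x (s x + c.eval s * a)) := fun a => by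
    rw [Function.update_comm htx, Formula.sat_update_of_notMem htφ]
  rw [Formula.sat_iff, Formula.sat_box_evolve]
  simp only [Formula.sat, Program.den, forall_eq, Cmp.rel, Term.eval, Function.update_self,
    Function.update_of_ne htr, Function.update_of_ne htx.symm, Function.update_of_ne hrx.symm,
    Term.eval_update_of_notMem htc, Term.eval_update_of_notMem hrc, hF, hφ, ge_iff_le]
  constructor
  · exact fun H a ha hdom => H a _ (ODE.isFlow_of_const_rhs he hxc ha hdom)
  · intro H a f hf
    rw [hf.eq_of_const_rhs he hxc hf.right_mem]
    refine H a hf.nonneg fun b hb => ?_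
    rw [← hf.eq_of_const_rhs he hxc hb]
    exact hf.domain b hb

theorem valid_diffPerm {ode ode' : ODE V} (F φ : Formula V) (h : ode.eqs.Perm ode'.eqs) :
    (Formula.imp (.box (.evolve ode F) φ) (.box (.evolve ode' F) φ)).Valid := by
  intro s
  rw [Formula.sat, Formula.sat_box_evolve, Formula.sat_box_evolve]
  refine fun H r f hf => H r f (hf.imp ?_ (fun _ _ q hq => ⟨q, h.subset hq, rfl, rfl⟩) hf.domain)
  ext x
  simp only [ODE.vars, h.mem_iff]

theorem valid_diffCongr {ode ode' : ODE V} {F : Formula V} (φ : Formula V)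
    {l₁ l₂ : List (V × Term V)} {x : V} {θ η : Term V} (h : ode.eqs = l₁ ++ (x, θ) :: l₂)
    (h' : ode'.eqs = l₁ ++ (x, η) :: l₂) (hF : (Formula.imp F (.cmp .eq θ η)).Valid) :
    (Formula.imp (.box (.evolve ode F) φ) (.box (.evolve ode' F) φ)).Valid := by
  intro s
  rw [Formula.sat, Formula.sat_box_evolve, Formula.sat_box_evolve]
  refine fun H r f hf => H r f
    (hf.imp (ODE.vars_eq_of_map_fst (by simp [h, h'])) (fun ζ hζ q hq => ?_) hf.domain)
  rw [h, List.mem_append, List.mem_cons] at hq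
  rcases hq with hq | rfl | hq
  · exact ⟨q, by simp [h', hq], rfl, rfl⟩
  · have := hF (f ζ)
    simp only [Formula.sat, Cmp.rel] at this
    exact ⟨(x, η), by simp [h'], rfl, (this (hf.domain ζ hζ)).symm⟩
  · exact ⟨q, by simp [h', hq], rfl, rfl⟩

/-- Soundness of the calculus of differential dynamic logic. -/
theorem Provable.valid {φ : Formula V} (h : Provable φ) : φ.Valid := by
  induction h with
  | mp _ _ ih₁ ih₂ =>
    intro s
    have := ih₁ s
    rw [Formula.sat] at this
    exact this (ih₂ s)
  | gen x _ ih =>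
    intro s
    rw [Formula.sat]
    exact fun d => ih _
  | goedel α _ ih =>
    intro s
    rw [Formula.sat]
    exact fun t _ => ih t
  | taut φ h => exact fun s => (φ.propEval_sat s).1 (h _)
  | arith φ _ h => exact h
  | allInst x θ φ =>
    intro s
    rw [Formula.sat, Formula.sat_box_assign, Formula.sat]
    exact fun H => H _
  | allDist x φ ψ =>
    intro s
    simp only [Formula.sat]
    exact fun H H' d => H d (H' d)
  | allVacuous x φ hx =>
    intro s
    simp only [Formula.sat]
    exact fun H d => (Formula.sat_update_of_notMem hx s d).2 H
  | exDual x φ =>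
    intro s
    simp only [Formula.sat_iff, Formula.sat, not_forall, not_not]
  | diaDual α φ =>
    intro s
    simp only [Formula.sat_iff, Formula.sat, not_forall, not_not, exists_prop]
  | assign x θ φ h =>
    intro s
    rw [Formula.sat_iff, Formula.sat_box_assign, φ.sat_subst x θ h, State.subst]
  | assignEq x θ φ hx =>
    intro s
    rw [Formula.sat_iff, Formula.sat_box_assign]
    simp only [Formula.sat, Cmp.rel, Term.eval, Function.update_self,
      Term.eval_update_of_notMem hx, forall_eq]
  | assignSelf x θ φ =>
    intro s
    rw [Formula.sat, Formula.sat_iff, Formula.sat_box_assign]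
    simp only [Formula.sat, Cmp.rel, Term.eval]
    intro h
    rw [← h, Function.update_eq_self]
  | boundRename x y θ φ hy => exact valid_boundRename x y θ hy
  | random x φ =>
    intro s
    rw [Formula.sat_iff]
    simp only [Formula.sat, Program.den]
    exact ⟨fun H d => H _ ⟨d, rfl⟩, fun H t ⟨d, ht⟩ => ht ▸ H d⟩
  | test F φ =>
    intro s
    rw [Formula.sat_iff]
    simp only [Formula.sat, Program.den, and_imp, forall_eq]
  | choice α β φ =>
    intro s
    rw [Formula.sat_iff]
    simp only [Formula.sat, Program.den, or_imp, forall_and]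
  | seq α β φ =>
    intro s
    rw [Formula.sat_iff]
    simp only [Formula.sat, Program.den]
    exact ⟨fun H u hu t ht => H t ⟨u, hu, ht⟩, fun H t ⟨u, hu, ht⟩ => H u hu t ht⟩
  | iterate α φ =>
    intro s
    rw [Formula.sat_iff]
    simp only [Formula.sat, Program.den]
    refine ⟨fun H => ⟨H s .refl, fun u hu t ht => H t (ht.head hu)⟩, fun H t ht => ?_⟩
    rcases ht.cases_head with rfl | ⟨u, hu, ht⟩
    · exact H.1
    · exact H.2 u hu t ht
  | modalK α φ ψ =>
    intro s
    simp only [Formula.sat]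
    exact fun H H' t ht => H t ht (H' t ht)
  | induction α φ =>
    intro s
    simp only [Formula.sat, Program.den]
    intro H hs t ht
    induction ht with
    | refl => exact hs
    | tail hu hstep ih => exact H _ hu ih _ hstep
  | convergence α v φ hv => exact valid_convergence φ hv
  | barcan α x φ hx =>
    intro s
    simp only [Formula.sat]
    exact fun H t ht d => H d _ (hx.den_update ht d)
  | vacuous α φ hd =>
    intro s
    simp only [Formula.sat]
    exact fun H t ht => (φ.sat_congr fun y hy =>
      α.den_eq_of_notMem_bv ht (hd.notMem_of_mem_left hy)).2 H
  | diffWeaken ode F =>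
    intro s
    rw [Formula.sat_box_evolve]
    exact fun r f hf => hf.domain r hf.right_mem
  | diffCut ode F C φ => exact valid_diffCut ode F C φ
  | diffInv ode F φ => exact valid_diffInv ode F φ
  | diffGhost ode ode' F φ y a b he hode hF hφ ha hb =>
    exact valid_diffGhost he hode hF hφ ha hb
  | diffSolve ode F φ x t r c he htx hrx htr hxc htc hrc htF hrF htφ =>
    exact valid_diffSolve he htx hrx htr hxc htc hrc htF hrF htφ
  | diffPerm ode ode' F φ h => exact valid_diffPerm F φ h
  | diffRefine ode F G φ _ ih =>
    intro s
    rw [Formula.sat, Formula.sat_box_evolve, Formula.sat_box_evolve]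
    refine fun H r f hf => H r f (hf.imp_domain fun ζ hζ => ?_)
    have := ih (f ζ)
    rw [Formula.sat] at this
    exact this (hf.domain ζ hζ)
  | diffCongr ode ode' F φ l₁ l₂ x θ η h h' _ ih => exact valid_diffCongr φ h h' ih

end Soundness

/-! ### μlearning processes -/

/-- Throughout a μlearning process an accurate model stays feasible, and all its states are
reachable by runs of the loop of that model. -/
theorem IsAccurate.mem_mon_and_reachable {V : Type*} [DecidableEq V] {A : Set (Action V)}
    {M : Set (MonitoredModel V)} {E : Action V → State V → State V} {P : Trace V}
    (hP : IsMuLearning A M E P) {m : MonitoredModel V} (hm : IsAccurate A E P m) (i : ℕ)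
    (hi : (i : ℕ∞) < P.length) :
    m ∈ P.Mon i ∧ (Program.star (.seq m.ctrl m.plant)).den (P.S 0) (P.S i) := by
  simp only [Program.den]
  induction i with
  | zero => exact ⟨hm.mem, .refl⟩
  | succ i ih =>
    obtain ⟨hmem, hreach⟩ := ih ((Nat.cast_lt.2 i.lt_succ_self).trans hi)
    have hA := hP.action_mem i hi
    have hctrl := m.cm_sound _ _ (hP.actions_safe i hi m hmem)
    have hplant := hm.realises _ hA _ hctrl
    rw [← hP.env i hi] at hplant
    exact ⟨hP.feasible_remain i hi m hmem (hm.mm_complete _ hA _ _ hctrl hplant),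
      hreach.tail ⟨_, hctrl, hplant⟩⟩

end DL

theorem mainTheorem1 {V : Type*} [DecidableEq V]
    (A : Set (DL.Action V)) (M : Set (DL.MonitoredModel V))
    (E : DL.Action V → DL.State V → DL.State V) (P : DL.Trace V)
    (hP : DL.IsMuLearning A M E P)
    (m : DL.MonitoredModel V) (hm : DL.IsAccurate A E P m) :
    ∀ i : ℕ, 0 < i → (i : ℕ∞) < P.length → m.safe.sat (P.S i) := by
  intro i _ hi
  have hvalid := hm.provable.valid (P.S 0)
  simp only [DL.MonitoredModel.formula, DL.modelFormula, DL.Formula.sat] at hvalid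
  exact hvalid hm.initial _ (hm.mem_mon_and_reachable hP i hi).2
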